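/- Let $k\ge 0$ be an integer. Consider commuting variables $x^{[l]}_i$ for $x\in\{e,h,f\}$, $1\le l\le k$, $i\in\mathbb Z$, $i\le -l$, and the currents $$x^{[l]}(z)=\sum_{i\le -l} z^{-i-l}\,x^{[l]}_i .$$ Write $p(z)^{(r)}$ for the $r$-th derivative of a series $p(z)$. Let $C_k$ be the quotient of the polynomial algebra over $\mathbb C$ in all the variables $x^{[l]}_i$ by the ideal generated by the coefficients of the following series, for all $1\le l,m\le k$ and $\alpha,\beta\ge 0$: $$x^{[l]}(z)^{(\alpha)}\,x^{[m]}(z)^{(\beta)}\quad\text{for } x=e,h,f,\ \ \alpha+\beta<2\min(l,m),$$ $$e^{[l]}(z)^{(\alpha)}\,h^{[m]}(z)^{(\beta)}\quad\text{and}\quad h^{[l]}(z)^{(\alpha)}\,f^{[m]}(z)^{(\beta)}\quad\text{for } \alpha+\beta<\max(0,l+m-k).$$ Assign the $(q,z,u)$-degree to the variables by $$\deg_q x^{[l]}_i=-i,\quad \deg_z e^{[l]}_i=2l,\ \deg_z h^{[l]}_i=0,\ \deg_z f^{[l]}_i=-2l,\quad \deg_u x^{[l]}_i=l,$$ and for $(a,b,s)\in\mathbb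 Z_{\ge0}\times\mathbb Z\times\mathbb Z_{\ge0}$ let $(C_k)_{a,b,s}$ be the image in $C_k$ of the span of the monomials of $(q,z,u)$-degree $(a,b,s)$. Then $C_k$ is the direct sum of the subspaces $(C_k)_{a,b,s}$, each of them is finite-dimensional, and the character $\mathrm{ch}_{q,z,u}\,C_k=\sum_{a,b,s}\dim (C_k)_{a,b,s}\;q^a z^b u^s$ is given, as an identity of formal series (coefficientwise convergent on the right), by $$\mathrm{ch}_{q,z,u}\,C_k=\sum_{\mathbf n^-,\mathbf n^0,\mathbf n^+\in\mathbb Z_{\ge0}^k} u^{|\mathbf n^+|+|\mathbf n^0|+|\mathbf n^-|}\,z^{2(|\mathbf n^+|-|\mathbf n^-|)}\,\frac{q^{\frac12(\mathbf n^+A\mathbf n^++\mathbf n^0A\mathbf n^0+\mathbf n^-A\mathbf n^-)+\mathbf n^+B\mathbf n^0+\mathbf n^0B\mathbf n^-}}{(q)_{\mathbf n^+}(q)_{\mathbf n^0}(q)_{\mathbf n^-}},$$ where $|\mathbf n|=\sum_{i=1}^k i\,n_i$, $(q)_{\mathbf n}=\prod_{j=1}^k (q)_{n_j}$, $(q)_n=\prod_{j=1}^n(1-q^j)$,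 and $A$, $B$ are the $k\times k$ matrices $$A_{i,j}=2\min(i,j),\qquad B_{i,j}=\max(0,i+j-k).$$ -/

import Mathlib

namespace QuadraticCk

open MvPolynomial

/-- The three types `e`, `h`, `f` of currents. -/
inductive Kind : Type
  | e
  | h
  | f

/-- The variables. The triple `(x, j, n)` stands for the variable `x^{[l]}_i` with `l = j + 1`
and `i = -l - n`; as `n` runs over the natural numbers, `i` runs over the integers `≤ -l`. -/
abbrev Var (k : ℕ) : Type := Kind × Fin k × ℕ

/-- The polynomial algebra over `ℂ` in the commuting variables. -/
abbrev Poly (k : ℕ) : Type := MvPolynomial (Var k) ℂ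

/-- The level `l = j + 1 ∈ {1, …, k}` attached to an index `j : Fin k`. -/
def lvl {k : ℕ} (j : Fin k) : ℕ := (j : ℕ) + 1

/-- The current `x^{[l]}(z) = ∑_{i ≤ -l} z^{-i-l} x^{[l]}_i = ∑_{n ≥ 0} z^n x^{[l]}_{-l-n}`. -/
noncomputable def current (k : ℕ) (x : Kind) (j : Fin k) : PowerSeries (Poly k) :=
  PowerSeries.mk fun n => X (x, j, n)

/-- The `r`-th (formal) derivative of a series in `z`. -/
noncomputable def currentDeriv (k : ℕ) (r : ℕ) (p : PowerSeries (Poly k)) : PowerSeries (Poly k) :=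
  (PowerSeries.derivative (Poly k))^[r] p

/-- `A_{l,m} = 2 min(l, m)` for `1 ≤ l, m ≤ k`. -/
def matA (k : ℕ) : Matrix (Fin k) (Fin k) ℕ :=
  Matrix.of fun i j => 2 * min (lvl i) (lvl j)

/-- `B_{l,m} = max(0, l + m - k)` for `1 ≤ l, m ≤ k` (the natural number subtraction is
truncated at `0`, which is the maximum with `0`). -/
def matB (k : ℕ) : Matrix (Fin k) (Fin k) ℕ :=
  Matrix.of fun i j => lvl i + lvl j - k

/-- The coefficients (in `z`) of the series `x^{[l]}(z)^{(α)} y^{[m]}(z)^{(β)}`, where `l`, `m`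
run over the levels and `α + β < M_{l,m}`. -/
def pairRelations (k : ℕ) (x y : Kind) (M : Matrix (Fin k) (Fin k) ℕ) : Set (Poly k) :=
  {p | ∃ (i j : Fin k) (α β N : ℕ), α + β < M i j ∧
    p = PowerSeries.coeff N (currentDeriv k α (current k x i) * currentDeriv k β (current k y j))}

/-- The defining relations of `C_k`. -/
def relations (k : ℕ) : Set (Poly k) :=
  (⋃ x : Kind, pairRelations k x x (matA k)) ∪
    pairRelations k .e .h (matB k) ∪ pairRelations k .h .f (matB k)

/-- The ideal of relations of `C_k`. -/
noncomputable def relIdeal (k : ℕ) : Ideal (Poly k) := Ideal.span (relations k)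

/-- The quadratic algebra `C_k`. -/
abbrev C (k : ℕ) : Type := Poly k ⧸ relIdeal k

/-- The `z`-degree of a variable of level `l` is `l` times this number. -/
def zSign : Kind → ℤ
  | .e => 2
  | .h => 0
  | .f => -2

/-- The `(q, z, u)`-degree of a variable: `deg_q x^{[l]}_i = -i = l + n`,
`deg_z x^{[l]}_i = 2l, 0, -2l` for `x = e, h, f`, and `deg_u x^{[l]}_i = l`. -/
def degree (k : ℕ) (v : Var k) : ℕ × ℤ × ℕ :=
  (lvl v.2.1 + v.2.2, zSign v.1 * (lvl v.2.1 : ℤ), lvl v.2.1)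

/-- The component of `C_k` of a given `(q, z, u)`-degree: the image of the span of the monomials
of this degree. -/
noncomputable def component (k : ℕ) (d : ℕ × ℤ × ℕ) : Submodule ℂ (C k) :=
  (weightedHomogeneousSubmodule ℂ (degree k) d).map
    (Ideal.Quotient.mkₐ ℂ (relIdeal k)).toLinearMap

/-- Formal sums `∑ c_{a,b,s} q^a z^b u^s` with integer coefficients, `a, s ≥ 0` and `b ∈ ℤ`,
given by their coefficients. The topology is that of coefficientwise stabilization (`ℤ` is
discrete), so that `HasSum` on this type is summation of formal series. -/
abbrev FormalSeries : Type := ℕ × ℤ × ℕ → ℤ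

/-- The `(q, z, u)`-character of `C_k`. -/
noncomputable def character (k : ℕ) : FormalSeries :=
  fun d => (Module.finrank ℂ (component k d) : ℤ)

/-- `u^s z^b P(q)`. -/
noncomputable def monomialTimes (s : ℕ) (b : ℤ) (P : PowerSeries ℤ) : FormalSeries :=
  fun d => if d.2.1 = b ∧ d.2.2 = s then PowerSeries.coeff d.1 P else 0

/-- `(q)_n = ∏_{j=1}^n (1 - q^j)`. -/
noncomputable def qFact (n : ℕ) : PowerSeries ℤ :=
  ∏ j ∈ Finset.Icc 1 n, (1 - PowerSeries.X ^ j)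

/-- `(q)_𝐧 = ∏_j (q)_{n_j}`. -/
noncomputable def qFactVec {k : ℕ} (n : Fin k → ℕ) : PowerSeries ℤ :=
  ∏ j, qFact (n j)

/-- The constant term of `(q)_𝐧` is `1`, so that `PowerSeries.invOfUnit (qFactVec n) 1` is its
inverse. -/
theorem qFactVec_mul_inv {k : ℕ} (n : Fin k → ℕ) :
    qFactVec n * PowerSeries.invOfUnit (qFactVec n) 1 = 1 := by
  apply PowerSeries.mul_invOfUnit
  rw [qFactVec, map_prod, Units.val_one]
  refine Finset.prod_eq_one fun j _ => ?_
  rw [qFact, map_prod]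
  refine Finset.prod_eq_one fun i hi => ?_
  have : i ≠ 0 := by have := (Finset.mem_Icc.1 hi).1; omega
  simp [this]

/-- `|𝐧| = ∑_{l=1}^k l n_l`. -/
def size {k : ℕ} (n : Fin k → ℕ) : ℕ := ∑ j, lvl j * n j

/-- `𝐚 M 𝐛 = ∑_{i,j} a_i M_{i,j} b_j`. -/
def bil {k : ℕ} (M : Matrix (Fin k) (Fin k) ℕ) (a b : Fin k → ℕ) : ℕ :=
  ∑ i, ∑ j, a i * M i j * b j

/-- The exponent of `q` in the fermionic sum, for `(𝐧⁻, 𝐧⁰, 𝐧⁺)`. -/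
def qExponent {k : ℕ} (nm n0 np : Fin k → ℕ) : ℕ :=
  (bil (matA k) np np + bil (matA k) n0 n0 + bil (matA k) nm nm) / 2 +
    bil (matB k) np n0 + bil (matB k) n0 nm

/-- The division by `2` in the exponent is exact, since the entries of `A` are even. -/
theorem two_dvd_bil_matA {k : ℕ} (a b : Fin k → ℕ) : 2 ∣ bil (matA k) a b := by
  refine Finset.dvd_sum fun i _ => Finset.dvd_sum fun j _ => ?_
  exact Dvd.dvd.mul_right (Dvd.dvd.mul_left (Dvd.intro _ rfl) _) _

/-- The summand of the fermionic sum for `(𝐧⁻, 𝐧⁰, 𝐧⁺)`: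
`u^{|𝐧⁺|+|𝐧⁰|+|𝐧⁻|} z^{2(|𝐧⁺|-|𝐧⁻|)} q^{…} / ((q)_{𝐧⁺} (q)_{𝐧⁰} (q)_{𝐧⁻})`. -/
noncomputable def fermionicTerm {k : ℕ} (nm n0 np : Fin k → ℕ) : FormalSeries :=
  monomialTimes (size np + size n0 + size nm) (2 * ((size np : ℤ) - (size nm : ℤ)))
    (PowerSeries.X ^ qExponent nm n0 np *
      (PowerSeries.invOfUnit (qFactVec np) 1 * PowerSeries.invOfUnit (qFactVec n0) 1 *
        PowerSeries.invOfUnit (qFactVec nm) 1))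

end QuadraticCk

/-! Pass to the dual. A colour is a kind together with a level. Fix the number n_c of variables of
each colour c, and a finite set σ with a colouring `w` having these multiplicities. On monomials
with this content a functional φ is recorded by the generating polynomial F = φ(∏_i w_i(X_i)), where
w_i(z) is the current of colour `w i`, truncated to a fixed total mode a. As φ varies, F runs
through all homogeneous polynomials of degree a invariant under colour-preserving permutations of σ.

Restricting a derivative of F to X_i = X_j inserts into φ a product of derivatives of two currents
(`coeff_collapse_genPoly`). Hence φ kills the relations with this content exactly when, for all i ≠
j, F vanishes on X_i = X_j to the order M attached to the two colours, that is, (X_i - X_j)^M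
divides F. The differences are primes, distinct for distinct pairs, so this means that F is
divisible by `diffProd w` (`diffProd_dvd_genPoly`, `map_ideal_eq_zero_of_diffProd_dvd`).

Since `diffProd w` is itself homogeneous and invariant, dividing by it leaves all invariants of
degree a - `diffDegree w` (`divisibleInvariants_add`). By the same duality without relations, these
are counted by the monomials of the polynomial algebra (`finrank_colorInvariants`), whose generating
series is ∏ 1/(q)_{n_c}. The power of q is `diffDegree w` plus the q-degree ∑ l n_c of the mode-zero
variables; together they form the quadratic form of the statement (`sum_lvl_add_diffDegree`). -/

namespace MvPolynomial

/-! ### Powers of X_i - X_j and vanishing on diagonals -/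

variable {σ K : Type*} [DecidableEq σ] [Field K]

/-- The substitution `X j ↦ X i`. -/
noncomputable def collapse (K : Type*) [Field K] (i j : σ) :
    MvPolynomial σ K →ₐ[K] MvPolynomial σ K :=
  rename (Function.update id j i)

theorem collapse_X (i j l : σ) : collapse K i j (X l) = X (if l = j then i else l) := by
  simp [collapse, Function.update_apply]

theorem collapse_X_sub_X_self (i j : σ) : collapse K i j (X i - X j) = 0 := by
  rw [map_sub, collapse_X, collapse_X, if_pos rfl]
  split_ifs <;> simp

theorem X_sub_X_dvd_sub_collapse (i j : σ) (g : MvPolynomial σ K) :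
    (X i - X j) ∣ g - collapse K i j g := by
  induction g using MvPolynomial.induction_on with
  | C a => simp [collapse]
  | add p q hp hq =>
    rw [map_add, add_sub_add_comm]
    exact dvd_add hp hq
  | mul_X p l hp =>
    have h : (X i - X j : MvPolynomial σ K) ∣ X l - collapse K i j (X l) := by
      rw [collapse_X]
      split_ifs with h
      · subst h
        exact ⟨-1, by ring⟩
      · simp
    rw [map_mul, show p * X l - collapse K i j p * collapse K i j (X l) =
      (p - collapse K i j p) * X l + collapse K i j p * (X l - collapse K i j (X l)) by ring]
    exact dvd_add (hp.mul_right _) (h.mul_left _)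

theorem collapse_eq_zero_iff {i j : σ} {g : MvPolynomial σ K} :
    collapse K i j g = 0 ↔ (X i - X j) ∣ g := by
  refine ⟨fun h => by simpa [h] using X_sub_X_dvd_sub_collapse i j g, ?_⟩
  rintro ⟨g, rfl⟩
  rw [map_mul, collapse_X_sub_X_self, zero_mul]

theorem X_sub_X_ne_zero {σ : Type*} {i j : σ} (hij : i ≠ j) : (X i - X j : MvPolynomial σ K) ≠ 0 :=
  sub_ne_zero.2 fun h => hij (X_injective h)

/-- The ideal it generates is the kernel of `collapse`, a homomorphism into a domain. -/
theorem prime_X_sub_X {i j : σ} (hij : i ≠ j) : Prime (X i - X j : MvPolynomial σ K) := by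
  rw [← Ideal.span_singleton_prime (X_sub_X_ne_zero hij)]
  have : Ideal.span {(X i - X j : MvPolynomial σ K)} = RingHom.ker (collapse K i j) := by
    ext g
    rw [Ideal.mem_span_singleton, RingHom.mem_ker, collapse_eq_zero_iff]
  rw [this]
  exact RingHom.ker_isPrime _

/-- By irreducibility it suffices that setting X_j = X_i does not identify X_l with X_m. -/
theorem isRelPrime_X_sub_X {i j l m : σ} (hij : i ≠ j) (hlm : l ≠ m)
    (h : ¬ (l = i ∧ m = j)) (h' : ¬ (l = j ∧ m = i)) :
    IsRelPrime (X i - X j : MvPolynomial σ K) (X l - X m) := by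
  rw [(prime_X_sub_X hij).irreducible.isRelPrime_iff_not_dvd, ← collapse_eq_zero_iff, map_sub,
    collapse_X, collapse_X, sub_eq_zero]
  intro e
  have := X_injective e
  split_ifs at this <;> grind

/-- Up to sign, `c i j` and `c j i` are exponents of the same prime. The order on σ selects one
prime per unordered pair, and the selected primes are pairwise coprime. -/
theorem prod_X_sub_X_pow_dvd {σ : Type*} [Fintype σ] [LinearOrder σ] (c : σ → σ → ℕ)
    {F : MvPolynomial σ K}
    (h : ∀ i j, i ≠ j → (X i - X j) ^ (c i j + c j i) ∣ F) :
    ∏ p ∈ Finset.univ.offDiag, (X p.1 - X p.2 : MvPolynomial σ K) ^ c p.1 p.2 ∣ F := by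
  have key : ∏ p ∈ (Finset.univ : Finset (σ × σ)) with p.1 < p.2,
      (X p.1 - X p.2 : MvPolynomial σ K) ^ (c p.1 p.2 + c p.2 p.1) ∣ F := by
    refine Finset.prod_dvd_of_isRelPrime ?_ ?_
    · intro p hp q hq hpq
      have hp : p.1 < p.2 := by simpa using hp
      have hq : q.1 < q.2 := by simpa using hq
      refine IsRelPrime.pow (isRelPrime_X_sub_X hp.ne hq.ne ?_ ?_)
      · rintro ⟨h1, h2⟩
        exact hpq (Prod.ext h1.symm h2.symm)
      · rintro ⟨h1, h2⟩
        rw [h1, h2] at hq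
        exact lt_asymm hp hq
    · intro p hp
      exact h _ _ (Finset.mem_filter.1 hp).2.ne
  refine dvd_trans ?_ key
  have hsplit : (Finset.univ : Finset σ).offDiag =
      ((Finset.univ : Finset (σ × σ)).filter fun p => p.1 < p.2) ∪
        ((Finset.univ : Finset (σ × σ)).filter fun p => p.2 < p.1) := by
    ext p
    simp [← lt_or_lt_iff_ne]
  have hdisj : Disjoint ((Finset.univ : Finset (σ × σ)).filter fun p => p.1 < p.2)
      ((Finset.univ : Finset (σ × σ)).filter fun p => p.2 < p.1) := by
    rw [Finset.disjoint_filter]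
    intro p _ h1 h2
    exact lt_asymm h1 h2
  have hswap : ∏ p ∈ (Finset.univ : Finset (σ × σ)) with p.2 < p.1,
        (X p.1 - X p.2 : MvPolynomial σ K) ^ c p.1 p.2 =
      ∏ p ∈ (Finset.univ : Finset (σ × σ)) with p.1 < p.2,
        (X p.2 - X p.1 : MvPolynomial σ K) ^ c p.2 p.1 :=
    Finset.prod_equiv (Equiv.prodComm σ σ) (by simp) (by simp)
  rw [hsplit, Finset.prod_union hdisj, hswap, ← Finset.prod_mul_distrib]
  refine Finset.prod_dvd_prod_of_dvd _ _ fun p _ => ?_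
  rw [pow_add]
  refine mul_dvd_mul_left _ (pow_dvd_pow_of_dvd ?_ _)
  rw [← neg_sub, neg_dvd]

/-- A derivation lowers divisibility by powers by at most one. -/
theorem pow_dvd_derivation {R A : Type*} [CommRing R] [CommRing A] [Algebra R A]
    (D : Derivation R A A) (x : A) {n : ℕ} {a : A} (h : x ^ (n + 1) ∣ a) : x ^ n ∣ D a := by
  obtain ⟨g, rfl⟩ := h
  rw [Derivation.leibniz, Derivation.leibniz_pow]
  refine dvd_add ?_ ?_
  · exact (pow_dvd_pow x n.le_succ).mul_right _
  · simp only [Nat.add_sub_cancel, smul_eq_mul, nsmul_eq_mul]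
    exact ⟨g * (((n + 1 : ℕ) : A) * D x), by ring⟩

theorem pow_dvd_iterate_derivation {R A : Type*} [CommRing R] [CommRing A] [Algebra R A]
    (D : Derivation R A A) (x : A) {n : ℕ} (r : ℕ) {a : A} (h : x ^ (n + r) ∣ a) :
    x ^ n ∣ D^[r] a := by
  induction r generalizing a with
  | zero => exact h
  | succ r ih => exact ih (pow_dvd_derivation D x h)

/-- Modulo x, only the Leibniz term in which all n derivatives fall on x^n survives. -/
theorem dvd_iterate_derivation_pow_mul_sub {R A : Type*} [CommRing R] [CommRing A] [Algebra R A]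
    (D : Derivation R A A) {x : A} (hx : D x = 1) (n : ℕ) (g : A) :
    x ∣ D^[n] (x ^ n * g) - (n.factorial : A) * g := by
  induction n generalizing g with
  | zero => simp
  | succ n ih =>
    have e : D (x ^ (n + 1) * g) = x ^ n * (((n + 1 : ℕ) : A) * g + x * D g) := by
      rw [Derivation.leibniz, Derivation.leibniz_pow, hx]
      simp only [Nat.add_sub_cancel, smul_eq_mul, nsmul_eq_mul]
      ring
    rw [Function.iterate_succ_apply, e]
    obtain ⟨y, hy⟩ := ih (((n + 1 : ℕ) : A) * g + x * D g)
    refine ⟨y + n.factorial * D g, ?_⟩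
    rw [Nat.factorial_succ]
    push_cast at hy ⊢
    linear_combination hy

/-- If F = (X_i - X_j)^M g, the M-th derivative of F restricts on the diagonal to M! times the
restriction of g, and M! ≠ 0. Derivatives in X_i alone are enough. -/
theorem X_sub_X_pow_dvd_of_collapse [CharZero K] {i j : σ} (hij : i ≠ j) (M : ℕ)
    {F : MvPolynomial σ K} (h : ∀ r < M, collapse K i j ((pderiv i)^[r] F) = 0) :
    (X i - X j) ^ M ∣ F := by
  induction M with
  | zero => simp
  | succ M ih =>
    obtain ⟨g, rfl⟩ := ih fun r hr => h r (hr.trans M.lt_succ_self)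
    rw [pow_succ]
    refine mul_dvd_mul_left _ (collapse_eq_zero_iff.1 ?_)
    have hD : pderiv i (X i - X j : MvPolynomial σ K) = 1 := by
      rw [map_sub, pderiv_X_self, pderiv_X_of_ne hij.symm, sub_zero]
    have h1 := collapse_eq_zero_iff.2 (dvd_iterate_derivation_pow_mul_sub _ hD M g)
    rw [map_sub, h M M.lt_succ_self, zero_sub, neg_eq_zero, map_mul, map_natCast] at h1
    exact (mul_eq_zero.1 h1).resolve_left (Nat.cast_ne_zero.2 M.factorial_ne_zero)

/-- Each derivative costs at most one power, so a factor X_i - X_j remains. -/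
theorem collapse_iterate_pderiv_of_dvd {i j : σ} {M α β : ℕ} (hM : α + β < M)
    {F : MvPolynomial σ K} (h : (X i - X j) ^ M ∣ F) :
    collapse K i j ((pderiv i)^[α] ((pderiv j)^[β] F)) = 0 := by
  rw [collapse_eq_zero_iff]
  obtain ⟨r, rfl⟩ : ∃ r, M = 1 + r + α + β := ⟨M - 1 - α - β, by omega⟩
  have := pow_dvd_iterate_derivation (pderiv i) _ α (pow_dvd_iterate_derivation (pderiv j) _ β h)
  exact (dvd_pow_self _ (by omega)).trans this

theorem coeff_iterate_pderiv {σ : Type*} (i : σ) (r : ℕ) (F : MvPolynomial σ K) (b : σ →₀ ℕ) :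
    coeff b ((pderiv i)^[r] F) =
      ((b i + 1).ascFactorial r : K) * coeff (b + Finsupp.single i r) F := by
  induction r generalizing b with
  | zero => simp
  | succ r ih =>
    have e : (b + Finsupp.single i 1 : σ →₀ ℕ) i + 1 = b i + 1 + 1 := by simp
    have h := Nat.succ_ascFactorial (b i + 1) r
    rw [Function.iterate_succ_apply', coeff_pderiv, ih, add_assoc, ← Finsupp.single_add,
      add_comm 1 r, e, Nat.ascFactorial_succ, ← h]
    push_cast
    ring

/-- The exponent N splits between X_i and X_j in all possible ways: the same convolution as in a
coefficient of a product of two currents. -/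
theorem coeff_collapse {i j : σ} (hij : i ≠ j) (F : MvPolynomial σ K) (e : σ →₀ ℕ) (hi : e i = 0)
    (hj : e j = 0) (N : ℕ) :
    coeff (e + Finsupp.single i N) (collapse K i j F) =
      ∑ p ∈ Finset.HasAntidiagonal.antidiagonal N,
        coeff (e + Finsupp.single i p.1 + Finsupp.single j p.2) F := by
  induction F using MvPolynomial.induction_on' with
  | add p q hp hq => simp only [map_add, coeff_add, hp, hq, Finset.sum_add_distrib]
  | monomial b a =>
    classical
    have hc : ∀ l, Finsupp.mapDomain (Function.update id j i) b l =
        if l = j then 0 else if l = i then b i + b j else b l := by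
      intro l
      induction b using Finsupp.induction_linear with
      | zero => simp
      | add u v hu hv => rw [Finsupp.mapDomain_add, Finsupp.add_apply, hu, hv]; grind [Finsupp.add_apply]
      | single x v =>
        rw [Finsupp.mapDomain_single, Function.update_apply, id]
        grind
    have hp : ∀ p : ℕ × ℕ, b = e + Finsupp.single i p.1 + Finsupp.single j p.2 ↔
        p = (b i, b j) ∧ ∀ l, l ≠ i → l ≠ j → b l = e l := by
      intro p
      rw [Finsupp.ext_iff]
      constructor
      · intro h
        refine ⟨Prod.ext ?_ ?_, fun l hl hl' => ?_⟩
        · simp [h i, hi, hij.symm]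
        · simp [h j, hj, hij]
        · simp [h l, hl.symm, hl'.symm]
      · rintro ⟨rfl, h⟩ l
        by_cases hl : l = i
        · subst hl; simp [hi, hij.symm]
        · by_cases hl' : l = j
          · subst hl'; simp [hj, hij]
          · simp [h l hl hl', Ne.symm hl, Ne.symm hl']
    have hm : Finsupp.mapDomain (Function.update id j i) b = e + Finsupp.single i N ↔
        b i + b j = N ∧ ∀ l, l ≠ i → l ≠ j → b l = e l := by
      rw [Finsupp.ext_iff]
      simp only [hc]
      constructor
      · intro h
        refine ⟨by simpa [hij, hi] using h i, fun l hl hl' => ?_⟩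
        simpa [hl, hl', hl.symm] using h l
      · rintro ⟨rfl, h⟩ l
        by_cases hl : l = i
        · subst hl; simp [hi, hij]
        · by_cases hl' : l = j
          · subst hl'; simp [hj, hij]
          · simp [h l hl hl', hl', hl]
    have hs : ∀ p ∈ Finset.HasAntidiagonal.antidiagonal N,
        coeff (e + Finsupp.single i p.1 + Finsupp.single j p.2) (monomial b a) =
          if p = (b i, b j) ∧ ∀ l, l ≠ i → l ≠ j → b l = e l then a else 0 := fun p _ => by
      rw [coeff_monomial, if_congr (hp p) rfl rfl]
    rw [Finset.sum_congr rfl hs, collapse, rename_monomial, coeff_monomial, if_congr hm rfl rfl]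
    by_cases h : ∀ l, l ≠ i → l ≠ j → b l = e l
    · simp only [and_iff_left h, Finset.sum_ite_eq', Finset.HasAntidiagonal.mem_antidiagonal]
    · simp [h]

/-- After the substitution X_j no longer occurs, so the coefficients tested here are the only ones
that could be nonzero. -/
theorem collapse_eq_zero_of_coeff {i j : σ} (hij : i ≠ j) {F : MvPolynomial σ K}
    (h : ∀ (e : σ →₀ ℕ) (N : ℕ), e i = 0 → e j = 0 →
      coeff (e + Finsupp.single i N) (collapse K i j F) = 0) :
    collapse K i j F = 0 := by
  ext b
  rw [coeff_zero]
  by_cases hb : b j = 0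
  · have e : b = b.erase i + Finsupp.single i (b i) := (Finsupp.erase_add_single _ _).symm
    rw [e]
    exact h _ _ (by simp) (by simp [hij.symm, hb])
  · by_contra hne
    obtain ⟨u, rfl, -⟩ := coeff_rename_ne_zero _ _ _ hne
    refine hb (Finsupp.mapDomain_of_notMem_range _ _ ?_)
    rintro ⟨l, hl⟩
    rw [Function.update_apply] at hl
    split_ifs at hl with h'
    · exact hij hl
    · exact h' hl

end MvPolynomial

/-! ### Colours and a uniform form of the relations -/

namespace QuadraticCk

open MvPolynomial

/-- The colours of the variables: a kind and a level. -/
abbrev Color (k : ℕ) : Type := Kind × Fin k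

/-- The variable with a given colour and mode. -/
def toVar {k : ℕ} (c : Color k) (a : ℕ) : Var k := (c.1, c.2, a)

/-- The colour of a variable. -/
def color {k : ℕ} (v : Var k) : Color k := (v.1, v.2.1)

/-- The mode of a variable. -/
def mode {k : ℕ} (v : Var k) : ℕ := v.2.2

instance : DecidableEq Kind := fun x y => by
  cases x <;> cases y <;> first | exact isTrue rfl | exact isFalse nofun

instance : Fintype Kind := ⟨{.e, .h, .f}, fun x => by cases x <;> decide⟩

/-- A matrix whose symmetrization is the matrix of the orders of vanishing imposed by the
defining relations. -/
def halfExp {k : ℕ} (c d : Color k) : ℕ :=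
  match c.1, d.1 with
  | .e, .e => min (lvl c.2) (lvl d.2)
  | .h, .h => min (lvl c.2) (lvl d.2)
  | .f, .f => min (lvl c.2) (lvl d.2)
  | .e, .h => matB k c.2 d.2
  | .h, .f => matB k c.2 d.2
  | _, _ => 0

/-- The `N`-th coefficient of the product of derivatives of two currents. -/
noncomputable def pairRel {k : ℕ} (c d : Color k) (α β N : ℕ) : Poly k :=
  PowerSeries.coeff N
    (currentDeriv k α (current k c.1 c.2) * currentDeriv k β (current k d.1 d.2))

theorem pairRel_comm {k : ℕ} (c d : Color k) (α β N : ℕ) :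
    pairRel c d α β N = pairRel d c β α N := by
  rw [pairRel, pairRel, mul_comm]

/-- Puts all families of relations in one form. The pairs h, e and f, h only repeat e, h and h, f by
commutativity, and the order for e with f is 0. -/
theorem mem_relations_iff {k : ℕ} (p : Poly k) :
    p ∈ relations k ↔ ∃ (c d : Color k) (α β N : ℕ),
      α + β < halfExp c d + halfExp d c ∧ p = pairRel c d α β N := by
  simp only [relations, pairRelations, Set.mem_union, Set.mem_iUnion, Set.mem_ofPred_eq]
  constructor
  · rintro ((⟨x, i, j, α, β, N, h, rfl⟩ | ⟨i, j, α, β, N, h, rfl⟩) | ⟨i, j, α, β, N, h, rfl⟩)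
    · refine ⟨(x, i), (x, j), α, β, N, ?_, rfl⟩
      cases x <;> simp only [halfExp, matA, Matrix.of_apply] at h ⊢ <;> omega
    · exact ⟨(.e, i), (.h, j), α, β, N, by simpa [halfExp] using h, rfl⟩
    · exact ⟨(.h, i), (.f, j), α, β, N, by simpa [halfExp] using h, rfl⟩
  · rintro ⟨⟨x, i⟩, ⟨y, j⟩, α, β, N, h, rfl⟩
    cases x <;> cases y
    case e.e | h.h | f.f =>
      refine Or.inl (Or.inl ⟨_, i, j, α, β, N, ?_, rfl⟩)
      simp only [halfExp, matA, Matrix.of_apply] at h ⊢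
      omega
    case e.h => exact Or.inl (Or.inr ⟨i, j, α, β, N, by simpa [halfExp] using h, rfl⟩)
    case h.f => exact Or.inr ⟨i, j, α, β, N, by simpa [halfExp] using h, rfl⟩
    case h.e =>
      exact Or.inl (Or.inr ⟨j, i, β, α, N, by simpa [halfExp, add_comm] using h,
        pairRel_comm _ _ _ _ _⟩)
    case f.h =>
      exact Or.inr ⟨j, i, β, α, N, by simpa [halfExp, add_comm] using h, pairRel_comm _ _ _ _ _⟩
    case e.f | f.e => simp [halfExp] at h

theorem pairRel_eq_sum {k : ℕ} (c d : Color k) (α β N : ℕ) :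
    pairRel c d α β N = ∑ p ∈ Finset.HasAntidiagonal.antidiagonal N,
      monomial (Finsupp.single (toVar c (p.1 + α)) 1 + Finsupp.single (toVar d (p.2 + β)) 1)
        (((p.1 + 1).ascFactorial α : ℂ) * ((p.2 + 1).ascFactorial β : ℂ)) := by
  rw [pairRel, PowerSeries.coeff_mul]
  refine Finset.sum_congr rfl fun p _ => ?_
  have h : ∀ (c : Color k) (α n : ℕ),
      PowerSeries.coeff n (currentDeriv k α (current k c.1 c.2)) =
        monomial (Finsupp.single (toVar c (n + α)) 1) (((n + 1).ascFactorial α : ℂ)) := by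
    intro c α n
    rw [currentDeriv, PowerSeries.coeff_iterate_derivative, current, PowerSeries.coeff_mk,
      toVar, X, ← map_natCast (MvPolynomial.C : ℂ →+* Poly k), C_mul_monomial, mul_one]
  rw [h, h, monomial_mul]

/-- The weight of a variable in the grading by colour content and total mode. -/
def fineWeight {k : ℕ} (v : Var k) : (Color k → ℕ) × ℕ := (Pi.single (color v) 1, mode v)

/-- The colour content and total mode of a monomial. -/
noncomputable def fineDegree {k : ℕ} : (Var k →₀ ℕ) →+ (Color k → ℕ) × ℕ :=
  Finsupp.weight fineWeight

theorem fineDegree_single {k : ℕ} (v : Var k) :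
    fineDegree (Finsupp.single v 1) = fineWeight v := by
  simp [fineDegree, Finsupp.weight_single]

theorem fineWeight_toVar {k : ℕ} (c : Color k) (a : ℕ) :
    fineWeight (toVar c a) = (Pi.single c 1, a) := rfl

/-! ### Generating polynomials of functionals -/

section Coloring

variable {k : ℕ} {σ : Type*} [Fintype σ] (w : σ → Color k)

/-- The monomial with one variable for each element of `σ`, of the given colour and mode. -/
noncomputable def mon (b : σ →₀ ℕ) : Var k →₀ ℕ := ∑ i, Finsupp.single (toVar (w i) (b i)) 1

/-- The number of elements of each colour. -/
noncomputable def content (c : Color k) : ℕ := Nat.card {i // w i = c}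

theorem fineDegree_mon (b : σ →₀ ℕ) : fineDegree (mon w b) = (content w, ∑ i, b i) := by
  simp only [mon, map_sum, fineDegree_single, fineWeight_toVar]
  refine Prod.ext ?_ ?_
  · ext c
    classical
    simp [Prod.fst_sum, content, Fintype.card_subtype, Pi.single_apply, eq_comm]
  · simp [Prod.snd_sum]

/-- Equal multiplicities give bijections between the fibres over each value, which glue. -/
theorem exists_equiv_of_sum_single_eq {α β γ : Type*} [Fintype α] [Fintype β]
    {f : α → γ} {g : β → γ}
    (h : ∑ i, Finsupp.single (f i) (1 : ℕ) = ∑ i, Finsupp.single (g i) 1) :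
    ∃ e : α ≃ β, ∀ i, g (e i) = f i := by
  classical
  have hc : ∀ c, Nonempty ({i // f i = c} ≃ {i // g i = c}) := fun c => by
    rw [← Fintype.card_eq, Fintype.card_subtype, Fintype.card_subtype]
    simpa [Finsupp.finsetSum_apply, Finsupp.single_apply] using DFunLike.congr_fun h c
  exact ⟨Equiv.ofFiberEquiv fun c => (hc c).some, fun i => Equiv.ofFiberEquiv_map _ i⟩

theorem exists_sum_single_eq {γ : Type*} (s : γ →₀ ℕ) :
    ∃ (n : ℕ) (f : Fin n → γ), ∑ i, Finsupp.single (f i) 1 = s := by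
  induction s using Finsupp.induction_linear with
  | zero => exact ⟨0, Fin.elim0, by simp⟩
  | add s t hs ht =>
    obtain ⟨n, f, rfl⟩ := hs
    obtain ⟨m, g, rfl⟩ := ht
    exact ⟨n + m, Fin.append f g, by simp [Fin.sum_univ_add]⟩
  | single x v => exact ⟨v, fun _ => x, by simp⟩

theorem exists_mon_eq {s : Var k →₀ ℕ} {a : ℕ} (h : fineDegree s = (content w, a)) :
    ∃ b : σ →₀ ℕ, mon w b = s := by
  classical
  obtain ⟨n, f, rfl⟩ := exists_sum_single_eq s
  have hc : ∀ c, Nonempty ({i // color (f i) = c} ≃ {i // w i = c}) := fun c => by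
    have := congrFun (congrArg Prod.fst h) c
    simp only [map_sum, fineDegree_single, fineWeight, Prod.fst_sum, Finset.sum_apply,
      Pi.single_apply, content] at this
    rw [Nat.card_eq_fintype_card] at this
    rw [← Fintype.card_eq, ← this, Fintype.card_subtype]
    simp [eq_comm]
  let e : Fin n ≃ σ := Equiv.ofFiberEquiv fun c => (hc c).some
  have he : ∀ i, w (e i) = color (f i) := fun i => Equiv.ofFiberEquiv_map _ i
  refine ⟨Finsupp.equivFunOnFinite.symm fun i => mode (f (e.symm i)), ?_⟩
  rw [mon, ← e.sum_comp]
  refine Finset.sum_congr rfl fun i _ => ?_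
  simp [he, toVar, color, mode]

theorem mon_mapDomain {π : Equiv.Perm σ} (hπ : ∀ i, w (π i) = w i) (b : σ →₀ ℕ) :
    mon w (b.mapDomain π) = mon w b := by
  rw [mon, mon, ← Equiv.sum_comp π]
  refine Finset.sum_congr rfl fun i _ => ?_
  rw [hπ, Finsupp.mapDomain_apply π.injective]

theorem exists_perm_of_mon_eq {b b' : σ →₀ ℕ} (h : mon w b = mon w b') :
    ∃ π : Equiv.Perm σ, (∀ i, w (π i) = w i) ∧ b.mapDomain π = b' := by
  obtain ⟨π, hπ⟩ := exists_equiv_of_sum_single_eq h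
  refine ⟨π, fun i => ?_, Finsupp.ext fun i => ?_⟩
  · exact congrArg color (hπ i)
  · obtain ⟨i, rfl⟩ := π.surjective i
    rw [Finsupp.mapDomain_apply π.injective]
    exact (congrArg mode (hπ i)).symm

variable [DecidableEq σ]

/-- The generating polynomial of the values of a functional on the monomials whose colour content
is that of `w` and whose total mode is `a`. -/
noncomputable def genPoly (a : ℕ) : Module.Dual ℂ (Poly k) →ₗ[ℂ] MvPolynomial σ ℂ :=
  ∑ b ∈ Finset.univ.finsuppAntidiag a,
    (monomial b).comp (LinearMap.applyₗ (monomial (mon w b) (1 : ℂ)))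

theorem coeff_genPoly (a : ℕ) (φ : Module.Dual ℂ (Poly k)) (b : σ →₀ ℕ) :
    coeff b (genPoly w a φ) = if ∑ i, b i = a then φ (monomial (mon w b) 1) else 0 := by
  simp [genPoly, LinearMap.sum_apply, coeff_sum, coeff_monomial, Finset.mem_finsuppAntidiag]

/-- The homogeneous polynomials of degree `a` invariant under colour-preserving permutations. -/
def colorInvariants (a : ℕ) : Submodule ℂ (MvPolynomial σ ℂ) where
  carrier := {F | F.IsHomogeneous a ∧ ∀ π : Equiv.Perm σ, (∀ i, w (π i) = w i) → rename π F = F}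
  zero_mem' := ⟨isHomogeneous_zero _ _ _, fun _ _ => map_zero _⟩
  add_mem' := fun hF hG => ⟨hF.1.add hG.1, fun π hπ => by rw [map_add, hF.2 π hπ, hG.2 π hπ]⟩
  smul_mem' := fun r F hF => ⟨by
    rw [smul_eq_C_mul]
    simpa using (isHomogeneous_C σ r).mul hF.1, fun π hπ => by rw [map_smul, hF.2 π hπ]⟩

theorem genPoly_mem (a : ℕ) (φ : Module.Dual ℂ (Poly k)) :
    genPoly w a φ ∈ colorInvariants w a := by
  refine ⟨fun b hb => ?_, fun π hπ => ?_⟩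
  · rw [coeff_genPoly] at hb
    change Finsupp.weight (fun _ => 1) b = a
    rw [← Finsupp.degree_eq_weight_one, Finsupp.degree_eq_sum]
    by_contra h
    exact hb (if_neg h)
  · ext b
    obtain ⟨b, rfl⟩ : ∃ b', b = Finsupp.mapDomain π b' :=
      ⟨b.mapDomain π.symm, by rw [← Finsupp.mapDomain_comp]; simp⟩
    rw [coeff_rename_mapDomain _ π.injective, coeff_genPoly, coeff_genPoly, mon_mapDomain w hπ,
      ← Equiv.sum_comp π (Finsupp.mapDomain π b)]
    simp only [Finsupp.mapDomain_apply π.injective]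

/-- The functional with a given generating polynomial, supported on a single fine degree. -/
theorem exists_genPoly_eq {a : ℕ} {F : MvPolynomial σ ℂ} (hF : F ∈ colorInvariants w a) :
    ∃ φ : Module.Dual ℂ (Poly k), genPoly w a φ = F ∧
      ∀ s, fineDegree s ≠ (content w, a) → φ (monomial s 1) = 0 := by
  classical
  -- The chosen labelling of s by σ is arbitrary: two labellings differ by a colour-preserving
  -- permutation, under which F is invariant.
  let f : (Var k →₀ ℕ) → ℂ := fun s =>
    if h : ∃ b, mon w b = s then coeff h.choose F else 0
  have hφ : ∀ s, (basisMonomials (Var k) ℂ).constr ℂ f (monomial s 1) = f s := fun s => by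
    rw [← Module.Basis.constr_basis (basisMonomials (Var k) ℂ) ℂ f s, coe_basisMonomials]
  have hz : ∀ b, ∑ i, b i ≠ a → coeff b F = 0 := fun b hb =>
    hF.1.coeff_eq_zero (by rwa [Finsupp.degree_eq_sum])
  refine ⟨(basisMonomials (Var k) ℂ).constr ℂ f, ?_, fun s hs => ?_⟩
  · ext b
    rw [coeff_genPoly, hφ]
    split_ifs with hb
    · have h : ∃ b', mon w b' = mon w b := ⟨b, rfl⟩
      obtain ⟨π, hπ, e⟩ := exists_perm_of_mon_eq w h.choose_spec
      simp only [f, dif_pos h]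
      conv_rhs => rw [← hF.2 π hπ, ← e]
      rw [coeff_rename_mapDomain _ π.injective]
    · exact (hz b hb).symm
  · rw [hφ]
    simp only [f]
    split_ifs with h
    · refine hz _ fun hb => hs ?_
      rw [← h.choose_spec, fineDegree_mon, hb]
    · rfl

theorem genPoly_eq_zero_iff (a : ℕ) (φ : Module.Dual ℂ (Poly k)) :
    genPoly w a φ = 0 ↔ ∀ s, fineDegree s = (content w, a) → φ (monomial s 1) = 0 := by
  constructor
  · intro h s hs
    obtain ⟨b, rfl⟩ := exists_mon_eq w hs
    have hb : ∑ i, b i = a := by simpa [fineDegree_mon] using hs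
    simpa [h, hb] using (coeff_genPoly w a φ b).symm
  · intro h
    ext b
    rw [coeff_genPoly]
    split_ifs with hb
    · rw [h _ (by rw [fineDegree_mon, hb]), coeff_zero]
    · rfl

end Coloring

theorem map_monomial {k : ℕ} (φ : Module.Dual ℂ (Poly k)) (s : Var k →₀ ℕ) (r : ℂ) :
    φ (monomial s r) = r * φ (monomial s 1) := by
  rw [← smul_eq_mul, ← map_smul, smul_monomial, smul_eq_mul, mul_one]

/-! ### Relations as divisibility of the generating polynomial -/

section Vanishing

variable {k : ℕ} {σ : Type*} [Fintype σ] (w : σ → Color k)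

/-- The product of the powers of the differences of the variables prescribed by the relations. -/
noncomputable def diffProd : MvPolynomial σ ℂ :=
  ∏ p ∈ Finset.univ.offDiag, (X p.1 - X p.2) ^ halfExp (w p.1) (w p.2)

/-- The degree of `diffProd`. -/
def diffDegree : ℕ := ∑ p ∈ (Finset.univ : Finset σ).offDiag, halfExp (w p.1) (w p.2)

theorem diffProd_ne_zero : diffProd w ≠ 0 :=
  Finset.prod_ne_zero_iff.2 fun _ hp =>
    pow_ne_zero _ (X_sub_X_ne_zero (Finset.mem_offDiag.1 hp).2.2)

theorem isHomogeneous_diffProd : (diffProd w).IsHomogeneous (diffDegree w) := by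
  refine IsHomogeneous.prod _ _ _ fun p _ => ?_
  simpa using ((isHomogeneous_X ℂ p.1).sub (isHomogeneous_X ℂ p.2)).pow (halfExp (w p.1) (w p.2))

theorem rename_diffProd {π : Equiv.Perm σ} (hπ : ∀ i, w (π i) = w i) :
    rename π (diffProd w) = diffProd w := by
  simp only [diffProd, map_prod, map_pow, map_sub, rename_X]
  refine Finset.prod_equiv (Equiv.prodCongr π π) (by simp) fun p _ => ?_
  simp [hπ]

variable [DecidableEq σ]

/-- The part of `mon` away from `i` and `j`. -/
noncomputable def monAway (i j : σ) (e : σ →₀ ℕ) : Var k →₀ ℕ :=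
  ∑ l ∈ (Finset.univ.erase i).erase j, Finsupp.single (toVar (w l) (e l)) 1

theorem mon_eq_monAway_add {i j : σ} (hij : i ≠ j) (b : σ →₀ ℕ) :
    mon w b = monAway w i j b +
      (Finsupp.single (toVar (w i) (b i)) 1 + Finsupp.single (toVar (w j) (b j)) 1) := by
  rw [mon, ← Finset.sum_erase_add _ _ (Finset.mem_univ i),
    ← Finset.sum_erase_add _ _ (Finset.mem_erase.2 ⟨hij.symm, Finset.mem_univ j⟩), monAway,
    add_assoc, add_comm (Finsupp.single (toVar (w j) (b j)) 1)]

theorem monAway_congr {i j : σ} {e b : σ →₀ ℕ} (h : ∀ l, l ≠ i → l ≠ j → b l = e l) :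
    monAway w i j b = monAway w i j e := by
  refine Finset.sum_congr rfl fun l hl => ?_
  rw [h l (by grind) (by grind)]

/-- The values of a functional on the multiples of a relation are the coefficients of the
restriction to a diagonal of a derivative of its generating polynomial. -/
theorem coeff_collapse_genPoly {i j : σ} (hij : i ≠ j) (a α β N : ℕ) {e : σ →₀ ℕ}
    (hi : e i = 0) (hj : e j = 0) (φ : Module.Dual ℂ (Poly k)) :
    coeff (e + Finsupp.single i N)
        (collapse ℂ i j ((pderiv i)^[α] ((pderiv j)^[β] (genPoly w a φ)))) =
      if ∑ l, e l + N + α + β = a then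
        φ (monomial (monAway w i j e) 1 * pairRel (w i) (w j) α β N) else 0 := by
  have hterm : ∀ p ∈ Finset.HasAntidiagonal.antidiagonal N,
      coeff (e + Finsupp.single i p.1 + Finsupp.single j p.2)
        ((pderiv i)^[α] ((pderiv j)^[β] (genPoly w a φ))) =
      if ∑ l, e l + N + α + β = a then
        φ (monomial (monAway w i j e) 1 *
          monomial (Finsupp.single (toVar (w i) (p.1 + α)) 1 +
            Finsupp.single (toVar (w j) (p.2 + β)) 1)
            (((p.1 + 1).ascFactorial α : ℂ) * ((p.2 + 1).ascFactorial β : ℂ))) else 0 := by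
    intro p hp
    have hb : e + Finsupp.single i p.1 + Finsupp.single j p.2 + Finsupp.single i α +
        Finsupp.single j β = e + Finsupp.single i (p.1 + α) + Finsupp.single j (p.2 + β) := by
      rw [Finsupp.single_add, Finsupp.single_add]
      abel
    have hbi : (e + Finsupp.single i p.1 + Finsupp.single j p.2 : σ →₀ ℕ) i = p.1 := by
      simp [hi, hij.symm]
    have hbj : (e + Finsupp.single i p.1 + Finsupp.single j p.2 + Finsupp.single i α : σ →₀ ℕ) j =
        p.2 := by
      simp [hj, hij]
    rw [coeff_iterate_pderiv, coeff_iterate_pderiv, hb, hbi, hbj, coeff_genPoly]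
    have hsum : ∑ l, (e + Finsupp.single i (p.1 + α) + Finsupp.single j (p.2 + β) : σ →₀ ℕ) l =
        ∑ l, e l + N + α + β := by
      rw [Finset.HasAntidiagonal.mem_antidiagonal] at hp
      simp only [Finsupp.add_apply, Finset.sum_add_distrib, Finsupp.single_apply,
        Finset.sum_ite_eq, Finset.mem_univ, if_true]
      omega
    have hmon : mon w (e + Finsupp.single i (p.1 + α) + Finsupp.single j (p.2 + β)) =
        monAway w i j e + (Finsupp.single (toVar (w i) (p.1 + α)) 1 +
          Finsupp.single (toVar (w j) (p.2 + β)) 1) := by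
      rw [mon_eq_monAway_add w hij, monAway_congr w (e := e)]
      · simp [hi, hj, hij, hij.symm]
      · intro l hl hl'
        simp [hl.symm, hl'.symm]
    rw [hsum, hmon, monomial_mul, one_mul]
    split_ifs
    · rw [map_monomial φ _ (_ * _), mul_assoc]
    · simp
  rw [coeff_collapse hij _ _ hi hj, pairRel_eq_sum, Finset.mul_sum, map_sum,
    Finset.sum_congr rfl hterm]
  split_ifs
  · rfl
  · exact Finset.sum_const_zero

theorem map_ideal_eq_zero_of_map_mul_eq_zero {φ : Module.Dual ℂ (Poly k)}
    (h : ∀ t, ∀ r ∈ relations k, φ (monomial t 1 * r) = 0) : ∀ p ∈ relIdeal k, φ p = 0 := by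
  have h' : ∀ r ∈ relations k, ∀ q : Poly k, φ (q * r) = 0 := by
    intro r hr q
    induction q using MvPolynomial.induction_on' with
    | add p q hp hq => rw [add_mul, map_add, hp, hq, add_zero]
    | monomial t a =>
      rw [← mul_one a, ← smul_eq_mul a, ← smul_monomial, smul_mul_assoc, map_smul, h t r hr, smul_zero]
  intro p hp
  suffices ∀ q : Poly k, φ (q * p) = 0 by simpa using this 1
  induction hp using Submodule.span_induction with
  | mem r hr => exact h' r hr
  | zero => simp
  | add p p' _ _ hp hp' => intro q; rw [mul_add, map_add, hp, hp', add_zero]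
  | smul x p _ hp => intro q; rw [smul_eq_mul, ← mul_assoc, hp]

theorem X_sub_X_pow_dvd_diffProd {i j : σ} (hij : i ≠ j) :
    (X i - X j) ^ (halfExp (w i) (w j) + halfExp (w j) (w i)) ∣ diffProd w := by
  have hsub : {(i, j), (j, i)} ⊆ (Finset.univ : Finset σ).offDiag := by
    intro p
    simp only [Finset.mem_insert, Finset.mem_singleton, Finset.mem_offDiag, Finset.mem_univ]
    rintro (rfl | rfl)
    · simpa using hij
    · simpa using hij.symm
  refine dvd_trans ?_ (Finset.prod_dvd_prod_of_subset _ _ _ hsub)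
  rw [Finset.prod_pair (by simp [hij]), pow_add]
  refine mul_dvd_mul_left _ (pow_dvd_pow_of_dvd ?_ _)
  rw [← neg_sub, neg_dvd]

/-- The relations with β = 0 already force the full order of vanishing on each diagonal. -/
theorem diffProd_dvd_genPoly {σ : Type*} [Fintype σ] [LinearOrder σ] (w : σ → Color k) (a : ℕ)
    {φ : Module.Dual ℂ (Poly k)} (h : ∀ p ∈ relIdeal k, φ p = 0) :
    diffProd w ∣ genPoly w a φ := by
  refine prod_X_sub_X_pow_dvd (fun i j => halfExp (w i) (w j)) fun i j hij => ?_
  refine X_sub_X_pow_dvd_of_collapse hij _ fun r hr =>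
    collapse_eq_zero_of_coeff hij fun e N hi hj => ?_
  have := coeff_collapse_genPoly w hij a r 0 N hi hj φ
  rw [Function.iterate_zero_apply] at this
  rw [this, h, ite_self]
  refine Ideal.mul_mem_left _ _ (Ideal.subset_span ?_)
  exact (mem_relations_iff _).2 ⟨_, _, r, 0, N, hr, rfl⟩

theorem fineDegree_add_pair (t : Var k →₀ ℕ) (c d : Color k) (x y : ℕ) :
    fineDegree (t + (Finsupp.single (toVar c x) 1 + Finsupp.single (toVar d y) 1)) =
      fineDegree t + (Pi.single c 1 + Pi.single d 1, x + y) := by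
  rw [map_add, map_add, fineDegree_single, fineDegree_single, fineWeight_toVar, fineWeight_toVar]
  rfl

theorem exists_ne_of_mon_eq {b : σ →₀ ℕ} {t : Var k →₀ ℕ} {c d : Color k} {x y : ℕ}
    (h : mon w b = t + (Finsupp.single (toVar c x) 1 + Finsupp.single (toVar d y) 1)) :
    ∃ i j, i ≠ j ∧ w i = c ∧ b i = x ∧ w j = d ∧ b j = y ∧ monAway w i j b = t := by
  have hsplit : ∀ {s : Finset σ} {u : Var k →₀ ℕ} {v : Var k},
      ∑ i ∈ s, Finsupp.single (toVar (w i) (b i)) 1 = u + Finsupp.single v 1 →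
      ∃ i ∈ s, toVar (w i) (b i) = v ∧
        ∑ i ∈ s.erase i, Finsupp.single (toVar (w i) (b i)) 1 = u := by
    intro s u v hs
    have hv : (∑ i ∈ s, Finsupp.single (toVar (w i) (b i)) (1 : ℕ)) v ≠ 0 := by simp [hs]
    rw [Finsupp.finsetSum_apply] at hv
    obtain ⟨i, hi, hne⟩ := Finset.exists_ne_zero_of_sum_ne_zero hv
    have hiv : toVar (w i) (b i) = v := by
      by_contra hne'
      exact hne (Finsupp.single_eq_of_ne (Ne.symm hne'))
    refine ⟨i, hi, hiv, ?_⟩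
    rw [← Finset.sum_erase_add _ _ hi, hiv] at hs
    exact add_right_cancel hs
  rw [mon, add_comm (Finsupp.single (toVar c x) 1), ← add_assoc] at h
  obtain ⟨i, -, hi, h⟩ := hsplit h
  obtain ⟨j, hj, hj', h⟩ := hsplit h
  exact ⟨i, j, (Finset.ne_of_mem_erase hj).symm, congrArg color hi, congrArg mode hi,
    congrArg color hj', congrArg mode hj', h⟩

/-- A monomial multiple of a relation lies in one fine degree. If that is the degree supporting φ,
its value is a coefficient of a derivative of the generating polynomial on a diagonal, which
vanishes. -/
theorem map_ideal_eq_zero_of_diffProd_dvd {a : ℕ} {φ : Module.Dual ℂ (Poly k)}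
    (h : diffProd w ∣ genPoly w a φ)
    (hφ : ∀ s, fineDegree s ≠ (content w, a) → φ (monomial s 1) = 0) :
    ∀ p ∈ relIdeal k, φ p = 0 := by
  refine map_ideal_eq_zero_of_map_mul_eq_zero fun t r hr => ?_
  obtain ⟨c, d, α, β, N, hlt, rfl⟩ := (mem_relations_iff _).1 hr
  by_cases hdeg :
      fineDegree t + (Pi.single c 1 + Pi.single d 1, α + (N + β)) = (content w, a)
  -- The term of the relation with modes α and N + β serves to label the variables by σ; any other
  -- term would do.
  · rw [← fineDegree_add_pair] at hdeg
    obtain ⟨b, hb⟩ := exists_mon_eq w hdeg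
    obtain ⟨i, j, hij, rfl, hi, rfl, hj, rfl⟩ := exists_ne_of_mon_eq w hb
    have hdvd := (X_sub_X_pow_dvd_diffProd w hij).trans h
    have hc := coeff_collapse_genPoly w hij a α β N (e := (b.erase i).erase j) (by simp [hij])
      (by simp) φ
    rw [collapse_iterate_pderiv_of_dvd hlt hdvd, coeff_zero, if_pos, monAway_congr w (e := b)] at hc
    · exact hc.symm
    · intro l hl hl'
      rw [Finsupp.erase_ne hl', Finsupp.erase_ne hl]
    · have hba : ∑ l, b l = a := by
        rw [← hb, fineDegree_mon] at hdeg
        exact congrArg Prod.snd hdeg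
      rw [← hba, ← Finset.sum_erase_add _ _ (Finset.mem_univ i),
        ← Finset.sum_erase_add _ b (Finset.mem_univ i),
        ← Finset.sum_erase_add _ _ (Finset.mem_erase.2 ⟨hij.symm, Finset.mem_univ j⟩),
        ← Finset.sum_erase_add _ b (Finset.mem_erase.2 ⟨hij.symm, Finset.mem_univ j⟩), hi, hj]
      have : ∀ l ∈ (Finset.univ.erase i).erase j, ((b.erase i).erase j) l = b l := by
        intro l hl
        rw [Finsupp.erase_ne (by grind), Finsupp.erase_ne (by grind)]
      rw [Finset.sum_congr rfl this]
      simp [hij]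
      ring
  · rw [pairRel_eq_sum, Finset.mul_sum, map_sum]
    refine Finset.sum_eq_zero fun p hp => ?_
    rw [monomial_mul, one_mul, map_monomial, hφ, mul_zero]
    rw [fineDegree_add_pair]
    rw [Finset.HasAntidiagonal.mem_antidiagonal] at hp
    rwa [show p.1 + α + (p.2 + β) = α + (N + β) by omega]

end Vanishing

theorem finrank_eq_of_ker_eq {K V W W' : Type*} [Field K] [AddCommGroup V] [Module K V]
    [AddCommGroup W] [Module K W] [AddCommGroup W'] [Module K W'] {f : V →ₗ[K] W} {g : V →ₗ[K] W'}
    (hf : Function.Surjective f) (hg : Function.Surjective g)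
    (h : LinearMap.ker f = LinearMap.ker g) : Module.finrank K W = Module.finrank K W' :=
  ((f.quotKerEquivOfSurjective hf).symm ≪≫ₗ Submodule.quotEquivOfEq _ _ h ≪≫ₗ
    g.quotKerEquivOfSurjective hg).finrank_eq

/-! ### Dimensions of spaces of invariants -/

section Invariants

variable {k : ℕ} {σ : Type*} [Fintype σ] (w : σ → Color k)

/-- The invariants of degree `a` have the dimension of the corresponding component of the
polynomial algebra. -/
theorem finrank_colorInvariants (a : ℕ)
    (hfin : {s : Var k →₀ ℕ | fineDegree s = (content w, a)}.Finite) :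
    Module.finrank ℂ (colorInvariants w a) =
      {s : Var k →₀ ℕ | fineDegree s = (content w, a)}.ncard := by
  classical
  let S := {s : Var k →₀ ℕ | fineDegree s = (content w, a)}
  have : Fintype S := hfin.fintype
  let f : Module.Dual ℂ (Poly k) →ₗ[ℂ] colorInvariants w a :=
    (genPoly w a).codRestrict _ (genPoly_mem w a)
  let g : Module.Dual ℂ (Poly k) →ₗ[ℂ] (S → ℂ) :=
    LinearMap.pi fun s => LinearMap.applyₗ (monomial s.1 (1 : ℂ))
  have hf : Function.Surjective f := fun F => by
    obtain ⟨φ, hφ, -⟩ := exists_genPoly_eq w F.2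
    exact ⟨φ, Subtype.ext hφ⟩
  have hg : Function.Surjective g := fun x => by
    refine ⟨(basisMonomials (Var k) ℂ).constr ℂ
      fun s => if h : s ∈ S then x ⟨s, h⟩ else 0, funext fun s => ?_⟩
    have := Module.Basis.constr_basis (basisMonomials (Var k) ℂ) ℂ
      (fun s => if h : s ∈ S then x ⟨s, h⟩ else 0) s.1
    rw [coe_basisMonomials] at this
    simpa [g] using this
  -- Both maps are surjective and kill exactly the functionals vanishing on the monomials in `S`.
  have hk : LinearMap.ker f = LinearMap.ker g := by
    ext φ
    rw [LinearMap.mem_ker, LinearMap.mem_ker, ← Subtype.coe_inj]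
    change genPoly w a φ = 0 ↔ _
    rw [genPoly_eq_zero_iff, funext_iff]
    exact ⟨fun h s => h s.1 s.2, fun h s hs => h ⟨s, hs⟩⟩
  rw [finrank_eq_of_ker_eq hf hg hk, Module.finrank_fintype_fun_eq_card,
    ← Nat.card_eq_fintype_card]
  rfl

/-- The invariants of degree `a` divisible by `diffProd`. -/
noncomputable def divisibleInvariants (a : ℕ) : Submodule ℂ (MvPolynomial σ ℂ) :=
  colorInvariants w a ⊓ (Ideal.span {diffProd w}).restrictScalars ℂ

theorem mem_divisibleInvariants {a : ℕ} {F : MvPolynomial σ ℂ} :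
    F ∈ divisibleInvariants w a ↔ F ∈ colorInvariants w a ∧ diffProd w ∣ F := by
  rw [divisibleInvariants, Submodule.mem_inf, Submodule.restrictScalars_mem,
    Ideal.mem_span_singleton]

attribute [local instance] MvPolynomial.gradedAlgebra

/-- The degree a part of P * g is P times the degree a - m part of g, or zero if a < m; then P is
cancelled. -/
theorem isHomogeneous_of_mul {τ R : Type*} [CommRing R] [IsDomain R] {P g : MvPolynomial τ R}
    {m a : ℕ} (hP : P.IsHomogeneous m) (h : (P * g).IsHomogeneous a) (hne : P * g ≠ 0) :
    m ≤ a ∧ g.IsHomogeneous (a - m) := by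
  classical
  have h1 := DirectSum.decompose_of_mem_same (homogeneousSubmodule τ R) h
  rw [DirectSum.coe_decompose_mul_of_left_mem (𝒜 := homogeneousSubmodule τ R) a hP] at h1
  split_ifs at h1 with hle
  · refine ⟨hle, ?_⟩
    rw [← mul_left_cancel₀ (left_ne_zero_of_mul hne) h1]
    exact SetLike.coe_mem (DirectSum.decompose (homogeneousSubmodule τ R) g (a - m))
  · exact absurd h1.symm hne

/-- `diffProd w` is homogeneous and invariant, so cancelling it in a domain passes both properties
to the quotient. -/
theorem divisibleInvariants_add (a : ℕ) :
    divisibleInvariants w (diffDegree w + a) =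
      (colorInvariants w a).map (LinearMap.mulLeft ℂ (diffProd w)) := by
  ext F
  rw [mem_divisibleInvariants, Submodule.mem_map]
  constructor
  · rintro ⟨hF, g, rfl⟩
    refine ⟨g, ⟨?_, fun π hπ => ?_⟩, rfl⟩
    · by_cases hne : diffProd w * g = 0
      · rw [(mul_eq_zero.1 hne).resolve_left (diffProd_ne_zero w)]
        exact isHomogeneous_zero _ _ _
      · simpa using (isHomogeneous_of_mul (isHomogeneous_diffProd w) hF.1 hne).2
    · have := hF.2 π hπ
      rw [map_mul, rename_diffProd w hπ] at this
      exact mul_left_cancel₀ (diffProd_ne_zero w) this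
  · rintro ⟨g, hg, rfl⟩
    refine ⟨⟨(isHomogeneous_diffProd w).mul hg.1, fun π hπ => ?_⟩, dvd_mul_right _ _⟩
    rw [LinearMap.mulLeft_apply, map_mul, rename_diffProd w hπ, hg.2 π hπ]

theorem finrank_divisibleInvariants_add (a : ℕ) :
    Module.finrank ℂ (divisibleInvariants w (diffDegree w + a)) =
      Module.finrank ℂ (colorInvariants w a) := by
  rw [divisibleInvariants_add]
  exact (Submodule.equivMapOfInjective _
    (mul_right_injective₀ (diffProd_ne_zero w)) _).finrank_eq.symm

theorem divisibleInvariants_of_lt {a : ℕ} (h : a < diffDegree w) :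
    divisibleInvariants w a = ⊥ := by
  rw [eq_bot_iff]
  intro F hF
  obtain ⟨hF, g, rfl⟩ := (mem_divisibleInvariants w).1 hF
  by_contra hne
  exact h.not_ge (isHomogeneous_of_mul (isHomogeneous_diffProd w) hF.1 hne).1

end Invariants

/-! ### Counting monomials by multisets of modes -/

section Counting

theorem finite_multiset_card_sum (n b : ℕ) :
    {m : Multiset ℕ | m.card = n ∧ m.sum = b}.Finite := by
  -- Every element is at most b and has multiplicity at most n.
  refine (Set.finite_Iic (n • (Finset.range (b + 1)).val)).subset ?_
  rintro m ⟨hn, hb⟩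
  refine Multiset.le_iff_count.2 fun x => ?_
  rw [Multiset.count_nsmul]
  by_cases hx : x ∈ m
  · have hxb : x ≤ b := hb ▸ Multiset.single_le_sum (fun _ _ => Nat.zero_le _) x hx
    rw [Multiset.count_eq_one_of_mem (Finset.range _).nodup (by simpa using by omega), mul_one,
      ← hn]
    exact Multiset.count_le_card x m
  · rw [Multiset.count_eq_zero.2 hx]
    exact Nat.zero_le _

/-- The multisets of `n` natural numbers with sum `b`. -/
noncomputable def multisetsOfSum (n b : ℕ) : Finset (Multiset ℕ) :=
  (finite_multiset_card_sum n b).toFinset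

theorem mem_multisetsOfSum {n b : ℕ} {m : Multiset ℕ} :
    m ∈ multisetsOfSum n b ↔ m.card = n ∧ m.sum = b := by
  simp [multisetsOfSum]

/-- The generating series of the multisets of `n` natural numbers by their sum. -/
noncomputable def multisetSeries (n : ℕ) : PowerSeries ℤ :=
  PowerSeries.mk fun b => ((multisetsOfSum n b).card : ℤ)

theorem multisetSeries_zero : multisetSeries 0 = 1 := by
  ext b
  rw [multisetSeries, PowerSeries.coeff_mk, PowerSeries.coeff_one]
  split_ifs with h
  · have : multisetsOfSum 0 b = {0} := by
      ext m
      rw [mem_multisetsOfSum, Multiset.card_eq_zero, Finset.mem_singleton]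
      exact ⟨And.left, fun hm => ⟨hm, by simp [hm, h]⟩⟩
    simp [this]
  · have : multisetsOfSum 0 b = ∅ := by
      refine Finset.eq_empty_of_forall_notMem fun m hm => ?_
      rw [mem_multisetsOfSum, Multiset.card_eq_zero] at hm
      rw [hm.1] at hm
      exact h (by simpa using hm.2.symm)
    simp [this]

theorem sum_map_succ (m : Multiset ℕ) : (m.map (· + 1)).sum = m.sum + m.card := by
  simp [Multiset.sum_map_add]

/-- Either 0 occurs and one copy is removed, or all n + 1 elements are positive and lowering each by
one lowers the sum by n + 1. This is the recursion of 1/(q)_n. -/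
theorem multisetsOfSum_succ (n b : ℕ) :
    multisetsOfSum (n + 1) b = 
      (multisetsOfSum n b).map ⟨(0 ::ₘ ·), fun _ _ h => (Multiset.cons_inj_right 0).1 h⟩ ∪
      (if n + 1 ≤ b then multisetsOfSum (n + 1) (b - (n + 1)) else ∅).map
        ⟨Multiset.map (· + 1), Multiset.map_injective (add_left_injective 1)⟩ := by
  ext m
  rw [Finset.mem_union, Finset.mem_map, Finset.mem_map, mem_multisetsOfSum]
  constructor
  · rintro ⟨hc, hs⟩
    by_cases h : 0 ∈ m
    · obtain ⟨m, rfl⟩ := Multiset.exists_cons_of_mem h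
      refine Or.inl ⟨m, ?_, rfl⟩
      rw [mem_multisetsOfSum]
      exact ⟨by simpa using hc, by simpa using hs⟩
    · have hm : (m.map Nat.pred).map (· + 1) = m := by
        rw [Multiset.map_map]
        conv_rhs => rw [← Multiset.map_id m]
        refine Multiset.map_congr rfl fun x hx => ?_
        have : x ≠ 0 := fun h0 => h (h0 ▸ hx)
        simp only [Function.comp_apply, Nat.pred_eq_sub_one, id]
        omega
      refine Or.inr ⟨m.map Nat.pred, ?_, hm⟩
      have := sum_map_succ (m.map Nat.pred)
      rw [hm, Multiset.card_map] at this
      rw [if_pos (by omega), mem_multisetsOfSum, Multiset.card_map]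
      omega
  · rintro (⟨m, hm, rfl⟩ | ⟨m, hm, rfl⟩)
    · rw [mem_multisetsOfSum] at hm
      change (0 ::ₘ m).card = _ ∧ (0 ::ₘ m).sum = _
      simpa using hm
    · split_ifs at hm with hb
      · rw [mem_multisetsOfSum] at hm
        change (m.map (· + 1)).card = _ ∧ (m.map (· + 1)).sum = _
        rw [sum_map_succ, Multiset.card_map]
        omega
      · simp at hm

theorem multisetSeries_succ (n : ℕ) :
    (1 - PowerSeries.X ^ (n + 1)) * multisetSeries (n + 1) = multisetSeries n := by
  rw [sub_mul, one_mul, sub_eq_iff_eq_add]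
  ext b
  rw [map_add, PowerSeries.coeff_X_pow_mul']
  simp only [multisetSeries, PowerSeries.coeff_mk]
  rw [multisetsOfSum_succ, Finset.card_union_of_disjoint, Finset.card_map, Finset.card_map]
  · split_ifs <;> simp
  · rw [Finset.disjoint_left]
    intro m h1 h2
    obtain ⟨m, -, rfl⟩ := Finset.mem_map.1 h1
    obtain ⟨m', -, h⟩ := Finset.mem_map.1 h2
    have h0 : 0 ∈ m'.map (· + 1) := by
      change m'.map (· + 1) = 0 ::ₘ m at h
      rw [h]
      exact Multiset.mem_cons_self _ _
    simp at h0

theorem qFact_mul_multisetSeries (n : ℕ) : qFact n * multisetSeries n = 1 := by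
  induction n with
  | zero => simp [qFact, multisetSeries_zero]
  | succ n ih =>
    rw [qFact, Finset.prod_Icc_succ_top (by omega), mul_assoc, multisetSeries_succ]
    exact ih

theorem invOfUnit_qFactVec {k : ℕ} (n : Fin k → ℕ) :
    PowerSeries.invOfUnit (qFactVec n) 1 = ∏ j, multisetSeries (n j) := by
  have h : qFactVec n * ∏ j, multisetSeries (n j) = 1 := by
    rw [qFactVec, ← Finset.prod_mul_distrib]
    exact Finset.prod_eq_one fun j _ => qFact_mul_multisetSeries _
  exact (left_inv_eq_right_inv (by rw [mul_comm, h]) (qFactVec_mul_inv n)).symm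

variable {k : ℕ}

/-- The monomial with given multisets of modes for each colour. -/
noncomputable def ofModes (t : Color k → Multiset ℕ) : Var k →₀ ℕ :=
  ∑ c, (Multiset.toFinsupp (t c)).mapDomain (toVar c)

theorem toVar_injective (c : Color k) : Function.Injective (toVar c) := fun _ _ h =>
  congrArg mode h

theorem ofModes_toVar (t : Color k → Multiset ℕ) (c : Color k) (a : ℕ) :
    ofModes t (toVar c a) = (t c).count a := by
  rw [ofModes, Finsupp.finsetSum_apply, Finset.sum_eq_single c]
  · rw [Finsupp.mapDomain_apply (toVar_injective c), Multiset.toFinsupp_apply]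
  · intro d _ hd
    refine Finsupp.mapDomain_of_notMem_range _ _ ?_
    rintro ⟨b, hb⟩
    exact hd (congrArg color hb)
  · simp

theorem ofModes_injective : Function.Injective (ofModes (k := k)) := fun t u h => by
  funext c
  ext a
  rw [← ofModes_toVar, h, ofModes_toVar]

theorem ofModes_surjective : Function.Surjective (ofModes (k := k)) := fun s => by
  refine ⟨fun c => Finsupp.toMultiset (s.comapDomain (toVar c) (toVar_injective c).injOn), ?_⟩
  ext v
  rw [show v = toVar (color v) (mode v) from rfl, ofModes_toVar, Finsupp.count_toMultiset,
    Finsupp.comapDomain_apply]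

theorem fineDegree_ofModes (t : Color k → Multiset ℕ) :
    fineDegree (ofModes t) = (fun c => (t c).card, ∑ c, (t c).sum) := by
  have h : ∀ (c : Color k) (m : Multiset ℕ),
      fineDegree ((Multiset.toFinsupp m).mapDomain (toVar c)) = (Pi.single c m.card, m.sum) := by
    intro c m
    induction m using Multiset.induction_on with
    | empty => simp; rfl
    | cons a m ih =>
      rw [← Multiset.singleton_add, map_add, Finsupp.mapDomain_add, map_add, ih,
        Multiset.toFinsupp_singleton, Finsupp.mapDomain_single, fineDegree_single,
        fineWeight_toVar, Multiset.card_add, Multiset.sum_add, Pi.single_add]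
      simp
  rw [ofModes, map_sum, Finset.sum_congr rfl fun c _ => h c (t c)]
  refine Prod.ext ?_ ?_
  · ext c
    simp [Prod.fst_sum, Finset.sum_apply, Pi.single_apply]
  · simp [Prod.snd_sum]

/-- Distributing the total mode among the colours matches the expansion of a coefficient of a
product of series. -/
theorem setOf_fineDegree_eq (n : Color k → ℕ) (a : ℕ) :
    {s : Var k →₀ ℕ | fineDegree s = (n, a)} = ofModes ''
      (((Finset.univ : Finset (Color k)).finsuppAntidiag a).biUnion fun f =>
        Fintype.piFinset fun c => multisetsOfSum (n c) (f c) : Finset (Color k → Multiset ℕ)) := by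
  ext s
  obtain ⟨t, rfl⟩ := ofModes_surjective s
  rw [Set.mem_ofPred_eq, ofModes_injective.mem_set_image, fineDegree_ofModes, Finset.mem_coe,
    Finset.mem_biUnion]
  simp only [Prod.mk.injEq, funext_iff, Fintype.mem_piFinset, mem_multisetsOfSum,
    Finset.mem_finsuppAntidiag]
  constructor
  · rintro ⟨h1, h2⟩
    exact ⟨Finsupp.equivFunOnFinite.symm fun c => (t c).sum, ⟨by simpa using h2, by simp⟩,
      fun c => ⟨h1 c, rfl⟩⟩
  · rintro ⟨f, ⟨hf, -⟩, h⟩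
    exact ⟨fun c => (h c).1, by rw [← hf]; exact Finset.sum_congr rfl fun c _ => (h c).2⟩

theorem finite_fineDegree_eq (n : Color k → ℕ) (a : ℕ) :
    {s : Var k →₀ ℕ | fineDegree s = (n, a)}.Finite := by
  rw [setOf_fineDegree_eq]
  exact (Finset.finite_toSet _).image _

theorem ncard_fineDegree_eq (n : Color k → ℕ) (a : ℕ) :
    ({s : Var k →₀ ℕ | fineDegree s = (n, a)}.ncard : ℤ) =
      PowerSeries.coeff a (∏ c, multisetSeries (n c)) := by
  rw [setOf_fineDegree_eq, Set.ncard_image_of_injective _ ofModes_injective, Set.ncard_coe_finset,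
    Finset.card_biUnion, PowerSeries.coeff_prod]
  · simp [multisetSeries, Fintype.card_piFinset]
  · intro f _ g _ hfg
    rw [Function.onFun, Finset.disjoint_left]
    intro t hf hg
    refine hfg (Finsupp.ext fun c => ?_)
    rw [Fintype.mem_piFinset] at hf hg
    rw [← (mem_multisetsOfSum.1 (hf c)).2, (mem_multisetsOfSum.1 (hg c)).2]

end Counting

/-! ### From colour content and total mode to the (q, z, u)-degree -/

variable {k : ℕ}

theorem one_le_lvl (j : Fin k) : 1 ≤ lvl j := Nat.le_add_left 1 j

/-- The `(q, z, u)`-degree of a monomial in terms of its colour content and total mode. -/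
def degreeOfFine : (Color k → ℕ) × ℕ →+ ℕ × ℤ × ℕ where
  toFun p := (∑ c, lvl c.2 * p.1 c + p.2, ∑ c, zSign c.1 * lvl c.2 * p.1 c,
    ∑ c, lvl c.2 * p.1 c)
  map_zero' := by simp
  map_add' p p' := by
    simp only [Prod.fst_add, Prod.snd_add, Pi.add_apply, Nat.cast_add, mul_add,
      Finset.sum_add_distrib, Prod.mk_add_mk]
    refine Prod.ext ?_ rfl
    exact add_add_add_comm _ _ _ _

theorem degreeOfFine_fineWeight (v : Var k) : degreeOfFine (fineWeight v) = degree k v := by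
  simp [degreeOfFine, fineWeight, degree, Pi.single_apply, color, mode]

theorem weight_degree (s : Var k →₀ ℕ) :
    Finsupp.weight (degree k) s = degreeOfFine (fineDegree s) := by
  obtain ⟨n, f, rfl⟩ := exists_sum_single_eq s
  simp only [map_sum, fineDegree_single, degreeOfFine_fineWeight, Finsupp.weight_single, one_smul]

theorem finite_degreeOfFine_eq (d : ℕ × ℤ × ℕ) :
    {p : (Color k → ℕ) × ℕ | degreeOfFine p = d}.Finite := by
  classical
  -- Levels are at least 1, so the u-degree bounds each multiplicity; the q-degree bounds the total
  -- mode.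
  refine (Set.finite_Icc 0 ((fun _ => d.2.2, d.1) : (Color k → ℕ) × ℕ)).subset ?_
  rintro ⟨n, a⟩ rfl
  refine ⟨bot_le, fun c => ?_, Nat.le_add_left _ _⟩
  calc n c ≤ lvl c.2 * n c := Nat.le_mul_of_pos_left _ (one_le_lvl _)
    _ ≤ _ := Finset.single_le_sum (f := fun c : Color k => lvl c.2 * n c)
        (fun _ _ => Nat.zero_le _) (Finset.mem_univ c)

/-- The pairs of a colour content and a total mode occurring in a given `(q, z, u)`-degree. -/
noncomputable def fineDegrees (d : ℕ × ℤ × ℕ) : Finset ((Color k → ℕ) × ℕ) :=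
  (finite_degreeOfFine_eq d).toFinset

theorem mem_fineDegrees {d : ℕ × ℤ × ℕ} {p : (Color k → ℕ) × ℕ} :
    p ∈ fineDegrees d ↔ degreeOfFine p = d := by
  simp [fineDegrees]

/-! ### The direct sum decomposition -/

section Internal

theorem isWeightedHomogeneous_pairRel (c d : Color k) (α β N : ℕ) :
    IsWeightedHomogeneous (degree k) (pairRel c d α β N)
      (degreeOfFine (Pi.single c 1 + Pi.single d 1, N + α + β)) := by
  rw [pairRel_eq_sum]
  refine IsWeightedHomogeneous.sum _ _ _ fun p hp => isWeightedHomogeneous_monomial _ _ _ ?_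
  have := fineDegree_add_pair (0 : Var k →₀ ℕ) c d (p.1 + α) (p.2 + β)
  rw [zero_add, map_zero, zero_add] at this
  rw [Finset.HasAntidiagonal.mem_antidiagonal] at hp
  rw [weight_degree, this, show p.1 + α + (p.2 + β) = N + α + β by omega]

attribute [local instance] MvPolynomial.weightedGradedAlgebra

theorem isHomogeneous_relIdeal :
    (relIdeal k).IsHomogeneous (weightedHomogeneousSubmodule ℂ (degree k)) := by
  refine Ideal.homogeneous_span _ _ fun r hr => ?_
  obtain ⟨c, d, α, β, N, -, rfl⟩ := (mem_relations_iff _).1 hr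
  exact ⟨_, isWeightedHomogeneous_pairRel c d α β N⟩

theorem iSup_weightedHomogeneousSubmodule_eq_top :
    ⨆ d, weightedHomogeneousSubmodule ℂ (degree k) d = ⊤ :=
  (DirectSum.Decomposition.isInternal
    (weightedHomogeneousSubmodule ℂ (degree k))).submodule_iSup_eq_top

/-- `C_k` is the direct sum of its components. -/
theorem isInternal_component : DirectSum.IsInternal (component k) := by
  classical
  rw [DirectSum.isInternal_submodule_iff_iSupIndep_and_iSup_eq_top]
  constructor
  · refine iSupIndep_def.2 fun d => ?_
    simp only [component, ← Submodule.map_iSup]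
    rw [Submodule.disjoint_def]
    rintro _ ⟨p, hp, rfl⟩ ⟨q, hq, hqp⟩
    -- The degree d part of p - q is p, and it lies in the ideal because the ideal is homogeneous.
    have hq0 : weightedHomogeneousComponent (degree k) d q = 0 := by
      have hle : ⨆ (d') (_ : d' ≠ d), weightedHomogeneousSubmodule ℂ (degree k) d' ≤
          LinearMap.ker (weightedHomogeneousComponent (degree k) d) := by
        refine iSup₂_le fun d' hd' p hp => ?_
        rw [LinearMap.mem_ker, weightedHomogeneousComponent_of_mem hp, if_neg hd'.symm]
      exact hle hq
    have hp0 : weightedHomogeneousComponent (degree k) d p = p := by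
      rw [weightedHomogeneousComponent_of_mem hp, if_pos rfl]
    have hmem : p - q ∈ relIdeal k := Ideal.Quotient.eq.1 hqp.symm
    have := weightedHomogeneousComponent_mem_of_mem ℂ (degree k) isHomogeneous_relIdeal hmem d
    rw [map_sub, hp0, hq0, sub_zero] at this
    exact Ideal.Quotient.eq_zero_iff_mem.2 this
  · change ⨆ d, (weightedHomogeneousSubmodule ℂ (degree k) d).map _ = ⊤
    rw [← Submodule.map_iSup, iSup_weightedHomogeneousSubmodule_eq_top, Submodule.map_top,
      LinearMap.range_eq_top]
    exact Ideal.Quotient.mkₐ_surjective ℂ _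

end Internal

/-! ### Finite-dimensionality and the dimension of a component -/

theorem finite_weight_degree_eq (d : ℕ × ℤ × ℕ) :
    {s : Var k →₀ ℕ | Finsupp.weight (degree k) s = d}.Finite := by
  refine ((finite_degreeOfFine_eq d).biUnion fun p _ => finite_fineDegree_eq p.1 p.2).subset ?_
  intro s hs
  simp only [Set.mem_iUnion]
  exact ⟨fineDegree s, (weight_degree s).symm.trans hs, rfl⟩

/-- The components of `C_k` are finite-dimensional. -/
theorem finiteDimensional_component (d : ℕ × ℤ × ℕ) : FiniteDimensional ℂ (component k d) := by
  have hle : weightedHomogeneousSubmodule ℂ (degree k) d ≤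
      Submodule.span ℂ ((fun s => monomial s (1 : ℂ)) ''
        {s : Var k →₀ ℕ | Finsupp.weight (degree k) s = d}) := by
    intro p hp
    rw [← support_sum_monomial_coeff p]
    refine Submodule.sum_mem _ fun s hs => ?_
    rw [← mul_one (coeff s p), ← smul_eq_mul, ← smul_monomial]
    exact Submodule.smul_mem _ _ (Submodule.subset_span ⟨s, hp (mem_support_iff.1 hs), rfl⟩)
  have := FiniteDimensional.span_of_finite ℂ
    ((finite_weight_degree_eq (k := k) d).image fun s => monomial s (1 : ℂ))
  have := Submodule.finiteDimensional_of_le hle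
  unfold component
  infer_instance

theorem exists_coloring (n : Color k → ℕ) : ∃ (N : ℕ) (w : Fin N → Color k), content w = n := by
  obtain ⟨N, w, h⟩ := exists_sum_single_eq (Finsupp.equivFunOnFinite.symm n)
  refine ⟨N, w, funext fun c => ?_⟩
  have := DFunLike.congr_fun h c
  simpa [content, Finsupp.finsetSum_apply, Finsupp.single_apply, Fintype.card_subtype] using this

/-- The dimension of a component as a sum over the possible colour contents. -/
theorem finrank_component (d : ℕ × ℤ × ℕ) {N : (Color k → ℕ) → ℕ} (w : ∀ n, Fin (N n) → Color k)
    (hw : ∀ n, content (w n) = n) :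
    Module.finrank ℂ (component k d) =
      ∑ p ∈ fineDegrees d, Module.finrank ℂ (divisibleInvariants (w p.1) p.2) := by
  classical
  let q : Poly k →ₗ[ℂ] C k := (Ideal.Quotient.mkₐ ℂ (relIdeal k)).toLinearMap
  have hq : ∀ p ∈ relIdeal k, q p = 0 := fun p hp => Ideal.Quotient.eq_zero_iff_mem.2 hp
  have hq' : ∀ p, q p = 0 → p ∈ relIdeal k := fun p hp => Ideal.Quotient.eq_zero_iff_mem.1 hp
  -- The map `g` and restriction to the component are surjections from the dual of `C k` with the
  -- same kernel, so their targets have equal dimension.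
  let g : Module.Dual ℂ (C k) →ₗ[ℂ]
      ((p : fineDegrees (k := k) d) → divisibleInvariants (w p.1.1) p.1.2) :=
    LinearMap.pi fun p => ((genPoly (w p.1.1) p.1.2).comp q.dualMap).codRestrict _ fun ψ =>
      (mem_divisibleInvariants _).2 ⟨genPoly_mem _ _ _, diffProd_dvd_genPoly _ _ fun r hr => by
        rw [LinearMap.dualMap_apply, hq r hr, map_zero]⟩
  have hg : Function.Surjective g := fun F => by
    have hF := fun p : fineDegrees (k := k) d => (mem_divisibleInvariants _).1 (F p).2
    choose φ hφ hsupp using fun p => exists_genPoly_eq _ (hF p).1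
    -- The functionals are supported in distinct fine degrees, so they do not interfere when summed.
    have hzero : ∀ p p', p' ≠ p → genPoly (w p.1.1) p.1.2 (φ p') = 0 := fun p p' hne => by
      rw [genPoly_eq_zero_iff]
      intro s hs
      refine hsupp p' s fun hs' => hne (Subtype.ext ?_)
      rw [hw] at hs hs'
      exact hs'.symm.trans hs
    have hker : ∀ r ∈ relIdeal k, (∑ p, φ p) r = 0 := fun r hr => by
      rw [LinearMap.sum_apply]
      refine Finset.sum_eq_zero fun p _ => ?_
      exact map_ideal_eq_zero_of_diffProd_dvd _ (by rw [hφ]; exact (hF p).2) (hsupp p) r hr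
    -- The sum of the functionals kills the ideal, so composing it with any linear section of `q`
    -- descends it to the quotient.
    obtain ⟨i, hi⟩ := q.exists_rightInverse_of_surjective
      (LinearMap.range_eq_top.2 (Ideal.Quotient.mkₐ_surjective ℂ _))
    refine ⟨(∑ p, φ p).comp i, funext fun p => Subtype.ext ?_⟩
    have hcomp : q.dualMap ((∑ p, φ p).comp i) = ∑ p, φ p := by
      refine LinearMap.ext fun r => ?_
      rw [LinearMap.dualMap_apply, LinearMap.comp_apply, ← sub_eq_zero, ← map_sub]
      refine hker _ (hq' _ ?_)
      rw [map_sub, ← LinearMap.comp_apply, hi, LinearMap.id_apply, sub_self]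
    change genPoly (w p.1.1) p.1.2 (q.dualMap ((∑ p, φ p).comp i)) = F p
    rw [hcomp, map_sum, Finset.sum_eq_single p (fun p' _ hne => hzero p p' hne) (by simp), hφ]
  have hk : LinearMap.ker (Submodule.dualRestrict (component k d)) = LinearMap.ker g := by
    ext ψ
    have h1 : g ψ = 0 ↔ ∀ s, Finsupp.weight (degree k) s = d → ψ (q (monomial s 1)) = 0 := by
      rw [funext_iff]
      have : ∀ p : fineDegrees (k := k) d, g ψ p = 0 ↔
          ∀ s, fineDegree s = p.1 → ψ (q (monomial s 1)) = 0 := fun p => by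
        rw [← Subtype.coe_inj]
        change genPoly (w p.1.1) p.1.2 (q.dualMap ψ) = 0 ↔ _
        rw [genPoly_eq_zero_iff, hw]
        rfl
      constructor
      · intro h s hs
        exact (this ⟨fineDegree s, mem_fineDegrees.2 ((weight_degree s).symm.trans hs)⟩).1 (h _) s
          rfl
      · intro h p
        refine (this p).2 fun s hs => h s ?_
        rw [weight_degree, hs, mem_fineDegrees.1 p.2]
    rw [LinearMap.mem_ker, LinearMap.mem_ker, h1, LinearMap.ext_iff]
    constructor
    · intro h s hs
      exact h ⟨_, Submodule.mem_map_of_mem (isWeightedHomogeneous_monomial _ _ _ hs)⟩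
    · rintro h ⟨_, p, hp, rfl⟩
      change ψ (q p) = 0
      rw [← support_sum_monomial_coeff p, map_sum, map_sum]
      refine Finset.sum_eq_zero fun s hs => ?_
      have := map_monomial (ψ.comp q) s (coeff s p)
      rw [LinearMap.comp_apply, LinearMap.comp_apply, h s (hp (mem_support_iff.1 hs)),
        mul_zero] at this
      exact this
  have hfin : ∀ p : fineDegrees (k := k) d,
      Module.Finite ℂ (divisibleInvariants (w p.1.1) p.1.2) := fun p => by
    have : Module.Finite ℂ (homogeneousSubmodule (Fin (N p.1.1)) ℂ p.1.2) :=
      Module.Finite.iff_fg.2 (weightedHomogeneousSubmodule_fg _ _ (fun _ => one_ne_zero) _)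
    exact Submodule.finiteDimensional_of_le (S₂ := homogeneousSubmodule _ ℂ p.1.2)
      fun F hF => ((mem_divisibleInvariants _).1 hF).1.1
  have := finrank_eq_of_ker_eq Subspace.dualRestrict_surjective hg hk
  rw [Subspace.dual_finrank_eq, Module.finrank_pi_fintype] at this
  rw [this, Finset.sum_coe_sort (fineDegrees d) fun p =>
    Module.finrank ℂ (divisibleInvariants (w p.1) p.2)]

/-! ### Matching with the fermionic sum -/

theorem sum_kind {M : Type*} [AddCommMonoid M] (f : Kind → M) : ∑ x, f x = f .e + f .h + f .f := by
  change ∑ x ∈ {Kind.e, Kind.h, Kind.f}, f x = _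
  rw [Finset.sum_insert (by decide), Finset.sum_pair (by decide), add_assoc]

theorem prod_kind {M : Type*} [CommMonoid M] (f : Kind → M) : ∏ x, f x = f .e * f .h * f .f := by
  change ∏ x ∈ {Kind.e, Kind.h, Kind.f}, f x = _
  rw [Finset.prod_insert (by decide), Finset.prod_pair (by decide), mul_assoc]

theorem finrank_divisibleInvariants {σ : Type*} [Fintype σ] (w : σ → Color k) (a : ℕ) :
    (Module.finrank ℂ (divisibleInvariants w a) : ℤ) =
      PowerSeries.coeff a (PowerSeries.X ^ diffDegree w * ∏ c, multisetSeries (content w c)) := by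
  rw [PowerSeries.coeff_X_pow_mul']
  split_ifs with h
  · obtain ⟨b, rfl⟩ := Nat.exists_eq_add_of_le h
    rw [finrank_divisibleInvariants_add, finrank_colorInvariants w b (finite_fineDegree_eq _ _),
      ncard_fineDegree_eq, Nat.add_sub_cancel_left]
  · rw [divisibleInvariants_of_lt w (not_le.1 h), finrank_bot, Nat.cast_zero]

theorem sum_comp_eq_sum_content {σ : Type*} [Fintype σ] (w : σ → Color k) (f : Color k → ℕ) :
    ∑ i, f (w i) = ∑ c, content w c * f c := by
  classical
  rw [← Finset.sum_fiberwise Finset.univ w]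
  refine Finset.sum_congr rfl fun c _ => ?_
  rw [Finset.sum_congr rfl fun i hi => by rw [(Finset.mem_filter.1 hi).2], Finset.sum_const,
    content, Nat.card_eq_fintype_card, Fintype.card_subtype, smul_eq_mul]

theorem halfExp_self (c : Color k) : halfExp c c = lvl c.2 := by
  obtain ⟨x, j⟩ := c
  cases x <;> simp [halfExp]

/-- The sum of `halfExp` over all ordered pairs in σ is the quadratic form. Its diagonal pairs
contribute `halfExp c c = lvl c.2`, exactly the q-degrees of the mode-zero variables; the other
pairs give `diffDegree w`. -/
theorem sum_lvl_add_diffDegree {σ : Type*} [Fintype σ] (w : σ → Color k) :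
    ∑ c, lvl c.2 * content w c + diffDegree w =
      ∑ c, ∑ d, content w c * halfExp c d * content w d := by
  classical
  have h1 : ∑ c, lvl c.2 * content w c = ∑ i, halfExp (w i) (w i) := by
    rw [sum_comp_eq_sum_content w fun c => halfExp c c]
    exact Finset.sum_congr rfl fun c _ => by rw [halfExp_self, mul_comm]
  have h2 : ∑ i, halfExp (w i) (w i) = ∑ p ∈ (Finset.univ : Finset σ).diag,
      halfExp (w p.1) (w p.2) := by
    rw [Finset.sum_diag]
  rw [h1, h2, diffDegree, ← Finset.sum_union (Finset.disjoint_diag_offDiag _),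
    Finset.diag_union_offDiag, Finset.sum_product,
    sum_comp_eq_sum_content w fun c => ∑ j, halfExp c (w j)]
  refine Finset.sum_congr rfl fun c _ => ?_
  rw [sum_comp_eq_sum_content w fun d => halfExp c d, Finset.mul_sum]
  exact Finset.sum_congr rfl fun d _ => by ring

/-- The numbers of variables of each colour as a triple of vectors. -/
def splitContent (n : Color k → ℕ) : (Fin k → ℕ) × (Fin k → ℕ) × (Fin k → ℕ) :=
  (fun j => n (.f, j), fun j => n (.h, j), fun j => n (.e, j))

theorem splitContent_injective : Function.Injective (splitContent (k := k)) := by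
  intro n m h
  simp only [splitContent, Prod.mk.injEq, funext_iff] at h
  funext ⟨x, j⟩
  cases x
  exacts [h.2.2 j, h.2.1 j, h.1 j]

theorem splitContent_surjective : Function.Surjective (splitContent (k := k)) := by
  rintro ⟨nm, n0, np⟩
  exact ⟨fun c => match c.1 with | .e => np c.2 | .h => n0 c.2 | .f => nm c.2, rfl⟩

theorem bil_matA_self (a : Fin k → ℕ) :
    bil (matA k) a a = 2 * ∑ i, ∑ j, a i * min (lvl i) (lvl j) * a j := by
  simp only [bil, matA, Matrix.of_apply, Finset.mul_sum]
  exact Finset.sum_congr rfl fun i _ => Finset.sum_congr rfl fun j _ => by ring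

/-- Half of A gives the blocks of `halfExp` with equal kinds, while each B block occurs for one
order of the kinds only and so is not doubled. -/
theorem qExponent_splitContent (n : Color k → ℕ) :
    qExponent (splitContent n).1 (splitContent n).2.1 (splitContent n).2.2 =
      ∑ c, ∑ d, n c * halfExp c d * n d := by
  rw [qExponent, bil_matA_self, bil_matA_self, bil_matA_self, ← mul_add, ← mul_add,
    Nat.mul_div_cancel_left _ two_pos]
  simp only [Fintype.sum_prod_type, sum_kind, halfExp, splitContent, bil, mul_zero, zero_mul,
    Finset.sum_const_zero, add_zero, zero_add, Finset.sum_add_distrib]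
  ring

theorem size_splitContent (n : Color k → ℕ) :
    size (splitContent n).2.2 + size (splitContent n).2.1 + size (splitContent n).1 =
      ∑ c, lvl c.2 * n c := by
  simp only [Fintype.sum_prod_type, sum_kind, size, splitContent]

theorem two_mul_size_splitContent (n : Color k → ℕ) :
    2 * ((size (splitContent n).2.2 : ℤ) - (size (splitContent n).1 : ℤ)) =
      ∑ c, zSign c.1 * lvl c.2 * n c := by
  simp only [Fintype.sum_prod_type, sum_kind, size, splitContent, zSign, zero_mul,
    add_zero, mul_assoc, ← Finset.mul_sum, Nat.cast_sum, Nat.cast_mul]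
  ring

theorem inv_qFactVec_splitContent (n : Color k → ℕ) :
    PowerSeries.invOfUnit (qFactVec (splitContent n).2.2) 1 *
      PowerSeries.invOfUnit (qFactVec (splitContent n).2.1) 1 *
        PowerSeries.invOfUnit (qFactVec (splitContent n).1) 1 = ∏ c, multisetSeries (n c) := by
  simp only [Fintype.prod_prod_type, prod_kind, invOfUnit_qFactVec, splitContent]

theorem fermionicTerm_splitContent (n : Color k → ℕ) (d : ℕ × ℤ × ℕ) :
    fermionicTerm (splitContent n).1 (splitContent n).2.1 (splitContent n).2.2 d =
      if d.2.1 = ∑ c, zSign c.1 * lvl c.2 * n c ∧ d.2.2 = ∑ c, lvl c.2 * n c then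
        PowerSeries.coeff d.1 (PowerSeries.X ^ (∑ c, ∑ c', n c * halfExp c c' * n c') *
          ∏ c, multisetSeries (n c)) else 0 := by
  rw [fermionicTerm, monomialTimes, qExponent_splitContent, inv_qFactVec_splitContent,
    size_splitContent, two_mul_size_splitContent]

/-- In a fixed degree d only finitely many contents contribute, and each determines the total mode,
so coefficientwise the sum is finite. -/
theorem hasSum_fermionicTerm : HasSum
    (fun n : (Fin k → ℕ) × (Fin k → ℕ) × (Fin k → ℕ) => fermionicTerm n.1 n.2.1 n.2.2)
    (character k) := by
  classical
  choose N w hw using exists_coloring (k := k)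
  refine Pi.hasSum.2 fun d => ?_
  have hexp : ∀ n : Color k → ℕ, ∑ c, ∑ c', n c * halfExp c c' * n c' =
      ∑ c, lvl c.2 * n c + diffDegree (w n) := fun n => by
    have := sum_lvl_add_diffDegree (w n)
    rw [hw] at this
    exact this.symm
  have hinj : Set.InjOn (fun p : (Color k → ℕ) × ℕ => splitContent p.1)
      (fineDegrees d : Finset ((Color k → ℕ) × ℕ)) := by
    rintro ⟨n, a⟩ hp ⟨m, b⟩ hp' h
    obtain rfl : n = m := splitContent_injective h
    have h1 := congrArg Prod.fst (mem_fineDegrees.1 hp)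
    have h2 := congrArg Prod.fst (mem_fineDegrees.1 hp')
    exact Prod.ext rfl (Nat.add_left_cancel (h1.trans h2.symm))
  have hsum : character k d = ∑ n ∈ (fineDegrees (k := k) d).image fun p => splitContent p.1,
      fermionicTerm n.1 n.2.1 n.2.2 d := by
    rw [Finset.sum_image hinj, character, finrank_component d w hw, Nat.cast_sum]
    refine Finset.sum_congr rfl fun p hp => ?_
    obtain ⟨n, a⟩ := p
    obtain rfl := mem_fineDegrees.1 hp
    rw [fermionicTerm_splitContent, if_pos ⟨rfl, rfl⟩, finrank_divisibleInvariants, hw, hexp,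
      pow_add, mul_assoc]
    change _ = PowerSeries.coeff (∑ c, lvl c.2 * n c + a) _
    rw [add_comm, PowerSeries.coeff_X_pow_mul]
  rw [hsum]
  refine hasSum_sum_of_ne_finset_zero fun x hx => ?_
  obtain ⟨n, rfl⟩ := splitContent_surjective x
  rw [fermionicTerm_splitContent]
  split_ifs with h
  · rw [hexp, PowerSeries.coeff_X_pow_mul', if_neg]
    intro hle
    -- A nonzero coefficient needs a q-degree of at least ∑ l n_c; the excess is the total mode,
    -- which would place n among the contents already summed.
    refine hx (Finset.mem_image.2 ⟨(n, d.1 - ∑ c, lvl c.2 * n c), mem_fineDegrees.2 ?_, rfl⟩)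
    refine Prod.ext ?_ (Prod.ext h.1.symm h.2.symm)
    change ∑ c, lvl c.2 * n c + (d.1 - ∑ c, lvl c.2 * n c) = d.1
    omega
  · rfl

end QuadraticCk

/-- The components of `C_k` of given `(q, z, u)`-degree are finite-dimensional, `C_k` is their
direct sum, and the `(q, z, u)`-character of `C_k` is the fermionic sum. -/
theorem mainTheorem3 (k : ℕ) :
    DirectSum.IsInternal (QuadraticCk.component k) ∧
    (∀ d : ℕ × ℤ × ℕ, FiniteDimensional ℂ (QuadraticCk.component k d)) ∧
    HasSum
      (fun n : (Fin k → ℕ) × (Fin k → ℕ) × (Fin k → ℕ) =>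
        QuadraticCk.fermionicTerm n.1 n.2.1 n.2.2)
      (QuadraticCk.character k) :=
  ⟨QuadraticCk.isInternal_component, QuadraticCk.finiteDimensional_component,
    QuadraticCk.hasSum_fermionicTerm⟩
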